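/- For complex $|q|<1$ write $(a;q)_\infty=\prod_{k\ge 0}(1-aq^k)$, $(a_1,\dots,a_m;q)_\infty=\prod_{i=1}^m (a_i;q)_\infty$ and $E_j=(q^j;q^j)_\infty$ for $j\ge 1$. Let $f(a,b)=\sum_{k=-\infty}^{\infty}a^{k(k+1)/2}b^{k(k-1)/2}$ for $|ab|<1$, and put $\varphi(q)=f(q,q)$ and $\psi(q)=f(q,q^3)$. Let the integers $a_{3,10}(n)$ be the coefficients of the Appell–Lerch sum $$\sum_{n=0}^{\infty} a_{3,10}(n)q^n = \frac{1}{(q^3, q^{7}, q^{10}; q^{10})_{\infty}} \sum_{n=-\infty}^{\infty} \frac{(-1)^n q^{5n(n+1)+3n+3}}{1 - q^{10n+3}},$$ expanded in powers of $q$ (in the region $0<|q|<1$, so that $\frac1{1-q^{-m}}=-\frac{q^{m}}{1-q^{m}}$ for $m>0$). Then $$2 \sum_{n=0}^{\infty} a_{3,10}(2n+1)q^n = \frac{E_1^2}{E_5} + 6q \frac{E_2 E_{10}^3}{E_1 E_5^2} - \frac{E_2^2}{E_1^2 E_5} \left(\varphi(q^2)\varphi(q^{10}) - 4q^3\psi(q^4)\psi(q^{20})\right),$$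 and for every integer $n\ge 0$, $$a_{3,10}(10n+5)\equiv 0 \pmod 5.$$ -/

import Mathlib

/-!
All `q`-series are formal power series in `q = X` with integer coefficients.  The infinite sums
and products are the (unconditional) `∑'` and `∏'` for the topology of coefficientwise convergence
on `ℤ⟦X⟧`, where `ℤ` is discrete.  `Ring.inverse f` is the inverse of `f` in the ring `ℤ⟦X⟧`; it is only used
for series with constant coefficient `1`, which are units.
-/

namespace AppellLerch

open PowerSeries
open scoped PowerSeries.WithPiTopology

/-- `(a; u)_∞ = ∏_{k ≥ 0} (1 - a u^k)`. -/
noncomputable def qPochInf (a u : ℤ⟦X⟧) : ℤ⟦X⟧ := ∏' k : ℕ, (1 - a * u ^ k)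

/-- `E_j = (q^j; q^j)_∞`. -/
noncomputable def E (j : ℕ) : ℤ⟦X⟧ := qPochInf (X ^ j) (X ^ j)

/-- Ramanujan's general theta function `f(a, b) = ∑_{k ∈ ℤ} a^{k(k+1)/2} b^{k(k-1)/2}`
(both exponents are nonnegative for every integer `k`). -/
noncomputable def theta (a b : ℤ⟦X⟧) : ℤ⟦X⟧ :=
  ∑' k : ℤ, a ^ (k * (k + 1) / 2).toNat * b ^ (k * (k - 1) / 2).toNat

/-- `φ(u) = f(u, u)`. -/
noncomputable def phi (u : ℤ⟦X⟧) : ℤ⟦X⟧ := theta u u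

/-- `ψ(u) = f(u, u³)`. -/
noncomputable def psi (u : ℤ⟦X⟧) : ℤ⟦X⟧ := theta u (u ^ 3)

/-- The expansion in powers of `q` (that is, for `0 < |q| < 1`) of `1 / (1 - q^d)`, where `d` is a
nonzero integer: for `d < 0` it is `1 / (1 - q^d) = -q^{-d} / (1 - q^{-d})`.
See `recipOneSub_mul`. -/
noncomputable def recipOneSub (d : ℤ) : ℤ⟦X⟧ :=
  if 0 < d then Ring.inverse (1 - X ^ d.toNat) else -X ^ (-d).toNat * Ring.inverse (1 - X ^ (-d).toNat)

/-- The term `(-1)^n q^{p n (n+1)/2 + j n + j} / (1 - q^{p n + j})` of the Appell-Lerch sum; for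
`1 ≤ j < p` the exponent of `q` in the numerator is nonnegative (`appellExponent_nonneg`). -/
noncomputable def appellTerm (j p : ℕ) (n : ℤ) : ℤ⟦X⟧ :=
  (-1) ^ n.natAbs * X ^ ((p : ℤ) * (n * (n + 1) / 2) + j * n + j).toNat *
    recipOneSub ((p : ℤ) * n + j)

/-- The Appell-Lerch sum
`1 / (q^j, q^{p-j}, q^p; q^p)_∞ * ∑_{n ∈ ℤ} (-1)^n q^{p n (n+1)/2 + j n + j} / (1 - q^{p n + j})`,
for `1 ≤ j < p`. -/
noncomputable def appellSeries (j p : ℕ) : ℤ⟦X⟧ :=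
  Ring.inverse
      (qPochInf (X ^ j) (X ^ p) * qPochInf (X ^ (p - j)) (X ^ p) * qPochInf (X ^ p) (X ^ p)) *
    ∑' n : ℤ, appellTerm j p n

/-- The coefficients `a_{j,p}(n)` of the Appell-Lerch sum. -/
noncomputable def a (j p n : ℕ) : ℤ := coeff n (appellSeries j p)

/-! Well-definedness of the inverses, sums and products above. -/

theorem isUnit_of_constantCoeff_eq_one {f : ℤ⟦X⟧} (h : constantCoeff f = 1) : IsUnit f := by
  rw [PowerSeries.isUnit_iff_constantCoeff, h]; exact isUnit_one

theorem isUnit_one_sub_X_pow {m : ℕ} (hm : m ≠ 0) : IsUnit (1 - X ^ m : ℤ⟦X⟧) :=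
  isUnit_of_constantCoeff_eq_one (by simp [hm])

/-- In the ring of Laurent series, `recipOneSub d` is the inverse of `1 - q^d`. -/
theorem recipOneSub_mul {d : ℤ} (hd : d ≠ 0) :
    HahnSeries.ofPowerSeries ℤ ℤ (recipOneSub d) * (1 - HahnSeries.single d 1) = 1 := by
  have key : ∀ m : ℕ, m ≠ 0 →
      HahnSeries.ofPowerSeries ℤ ℤ (Ring.inverse (1 - X ^ m)) * (1 - HahnSeries.single (m : ℤ) 1) = 1 := by
    intro m hm
    have h := congrArg (HahnSeries.ofPowerSeries ℤ ℤ)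
      (Ring.inverse_mul_cancel _ (isUnit_one_sub_X_pow hm))
    simpa [HahnSeries.ofPowerSeries_X_pow] using h
  unfold recipOneSub
  split_ifs with h
  · obtain ⟨m, rfl⟩ := Int.eq_ofNat_of_zero_le h.le
    simpa using key m (by rintro rfl; simp at h)
  · obtain ⟨m, hm⟩ := Int.eq_ofNat_of_zero_le (a := -d) (by lia)
    obtain rfl : d = -(m : ℤ) := by lia
    have hm0 : m ≠ 0 := by rintro rfl; simp at hd
    have hs : (HahnSeries.single (m : ℤ) (1 : ℤ)) * HahnSeries.single (-(m : ℤ)) 1 = 1 := by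
      rw [HahnSeries.single_mul_single]; simp
    have hk := key m hm0
    simp only [neg_neg, Int.toNat_natCast, map_mul, map_neg, HahnSeries.ofPowerSeries_X_pow]
    linear_combination hk + HahnSeries.ofPowerSeries ℤ ℤ (Ring.inverse (1 - X ^ m)) * hs

theorem multipliable_qPochInf (a : ℤ⟦X⟧) {u : ℤ⟦X⟧} (hu : constantCoeff u = 0) :
    Multipliable fun k : ℕ => 1 - a * u ^ k := by
  simp_rw [sub_eq_add_neg]
  apply WithPiTopology.multipliable_one_add_of_tendsto_order_atTop_nhds_top
  refine ENat.tendsto_nhds_top_iff_natCast_lt.mpr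
    (fun n => Filter.eventually_atTop.mpr ⟨n + 1, fun m hm => ?_⟩)
  have h : (X : ℤ⟦X⟧) ^ m ∣ -(a * u ^ m) :=
    ((pow_dvd_pow_of_dvd (X_dvd_iff.mpr hu) m).mul_left a).neg_right
  refine lt_of_lt_of_le ?_ (nat_le_order _ m (X_pow_dvd_iff.mp h))
  exact_mod_cast hm

theorem constantCoeff_qPochInf {a u : ℤ⟦X⟧} (ha : constantCoeff a = 0) (hu : constantCoeff u = 0) :
    constantCoeff (qPochInf a u) = 1 := by
  unfold qPochInf
  rw [(multipliable_qPochInf a hu).map_tprod _ (WithPiTopology.continuous_constantCoeff ℤ)]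
  simp [ha]

theorem summable_of_X_pow_dvd {f : ℤ → ℤ⟦X⟧} (h : ∀ n, X ^ (n.natAbs - 1) ∣ f n) : Summable f := by
  rw [WithPiTopology.summable_iff_summable_coeff]
  intro d
  refine summable_of_hasFiniteSupport ((Set.finite_Icc (-(d + 1 : ℤ)) (d + 1)).subset ?_)
  intro n hn
  by_contra hc
  refine hn (X_pow_dvd_iff.mp (h n) d ?_)
  simp only [Set.mem_Icc, not_and_or] at hc
  lia

theorem two_mul_tri (n : ℤ) : 2 * (n * (n + 1) / 2) = n * (n + 1) :=
  Int.mul_ediv_cancel' (Int.even_mul_succ_self n).two_dvd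

theorem summable_theta {a b : ℤ⟦X⟧} (ha : constantCoeff a = 0) (hb : constantCoeff b = 0) :
    Summable fun k : ℤ => a ^ (k * (k + 1) / 2).toNat * b ^ (k * (k - 1) / 2).toNat := by
  refine summable_of_X_pow_dvd fun k => ?_
  have h1 := pow_dvd_pow_of_dvd (X_dvd_iff.mpr ha) (k * (k + 1) / 2).toNat
  have h2 := pow_dvd_pow_of_dvd (X_dvd_iff.mpr hb) (k * (k - 1) / 2).toNat
  refine dvd_trans ?_ (mul_dvd_mul h1 h2)
  rw [← pow_add]
  apply pow_dvd_pow
  have e1 := two_mul_tri k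
  have e2 := two_mul_tri (k - 1)
  rw [sub_add_cancel, mul_comm (k - 1) k] at e2
  rcases le_or_gt 0 k with hk | hk
  · have : k ≤ k * (k + 1) / 2 := by
      have : k ≤ k * k := by rcases hk.eq_or_lt with h | h <;> nlinarith
      lia
    lia
  · have : -k ≤ k * (k - 1) / 2 := by nlinarith
    lia

theorem appellExponent_nonneg {j p : ℕ} (hjp : j < p) (n : ℤ) :
    0 ≤ (p : ℤ) * (n * (n + 1) / 2) + j * n + j := by
  have e := two_mul_tri n
  have hp : (j : ℤ) + 1 ≤ p := by exact_mod_cast hjp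
  have hj : (0 : ℤ) ≤ j := by positivity
  have e2 : 2 * ((p : ℤ) * (n * (n + 1) / 2) + j * n + j) = (n + 1) * (p * n + 2 * j) := by
    linear_combination (p : ℤ) * e
  suffices 0 ≤ (n + 1) * (p * n + 2 * j) by lia
  rcases lt_trichotomy n (-1) with hn | rfl | hn
  · exact mul_nonneg_of_nonpos_of_nonpos (by lia) (by nlinarith)
  · simp
  · have hn' : 0 ≤ n := by lia
    positivity

theorem summable_appellTerm {j p : ℕ} (hjp : j < p) : Summable (appellTerm j p) := by
  refine summable_of_X_pow_dvd fun n => ?_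
  have e := two_mul_tri n
  have h0 := appellExponent_nonneg hjp n
  have hp : (j : ℤ) + 1 ≤ p := by exact_mod_cast hjp
  have hj : (0 : ℤ) ≤ j := by positivity
  unfold appellTerm
  rcases le_or_gt 0 n with hn | hn
  · refine (Dvd.dvd.mul_left (pow_dvd_pow X ?_) _).mul_right _
    have h1 : n ≤ n * (n + 1) / 2 := by
      have : n ≤ n * n := by rcases hn.eq_or_lt with h | h <;> nlinarith
      lia
    have h2 : n ≤ p * (n * (n + 1) / 2) := by nlinarith
    have h3 : 0 ≤ j * n := by positivity
    lia
  · have hd : (p : ℤ) * n + j < 0 := by nlinarith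
    rw [recipOneSub, if_neg (by lia), ← mul_assoc, mul_assoc ((-1) ^ n.natAbs), mul_neg,
      ← pow_add]
    refine Dvd.dvd.mul_right (Dvd.dvd.mul_left ((dvd_neg (α := ℤ⟦X⟧)).mpr (pow_dvd_pow X ?_)) _) _
    have h1 : -2 * n ≤ 2 * (((p : ℤ) * (n * (n + 1) / 2) + j * n + j) + -(p * n + j)) := by
      have : 2 * (((p : ℤ) * (n * (n + 1) / 2) + j * n + j) + -(p * n + j)) =
          (-n) * (p * (1 - n) - 2 * j) := by linear_combination (p : ℤ) * e
      rw [this]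
      have : 2 ≤ (p : ℤ) * (1 - n) - 2 * j := by nlinarith
      nlinarith
    lia

end AppellLerch

namespace AppellLerch

open PowerSeries
open scoped PowerSeries.WithPiTopology

/-! ### Summable families of power series -/

/-! Write J_k for `T 5 k (-1)`, Φ for `phiPsi`, and f for the series `appellSeries 3 10`. The proof
has three ingredients.

The odd part of f is a theta quotient. Up to sign J_3 f is the Appell-Lerch sum `appellSum 5 3 1
(-1)`, and q ↦ -q only changes the sign δ in it. Shifting the elliptic variable of `appellSum` by a
period gives a functional equation with an inhomogeneous theta term. In `appellDiff` these terms
cancel between δ = 1 and δ = -1, so the difference f(q) - f(-q) transforms like a theta series.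
Summing it against a Gaussian weight and inserting the partial fraction expansion of 1/theta
(`T_mul_tsum_recip`) evaluates it as a product: `appellDiff_formula`, `odd_part_appellSeries`.

The dissection then becomes an identity between theta series, 2q J_1² J_4 J_5 = J_2 J_3 (J_5² + 2q
J_1 J_3 - Φ), which is `phiPsi_formula`. With P = J_2² J_3³ J_5, Q = q J_1³ J_4² J_5 and D = J_1 J_2
J_3 J_4, the three-term relations give P + Q = D (J_5² + 2q J_1 J_3) (`T_five_sextic`), and
`phiPsi_sq` gives Φ² = J_5⁴ + 4q² J_1² J_3². Hence (P - Q)² = (P + Q)² - 4PQ = D² Φ², and constant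
terms select P - Q = D Φ. Converting J_5, J_1 J_3 and φ(-q)² = J_5² - 4q J_1 J_3 to eta products
gives the stated form.

For the congruence put U = E_2/E_1. Up to factors that are series in q⁵, the odd part is U² (J_5² +
2q J_1 J_3 - Φ). Its two pieces reduce, again up to such factors and substitutions q ↦ q², q ↦ -q,
to ψ(q)⁴ - q² ψ(q⁵)⁴ and ψ(q)³ - q ψ(q⁵)² ψ(q). In the 5-dissection ψ(q²) = A + B + C, with
exponents 0, 2, 1 modulo 5, one has q² ψ(q¹⁰)² = AB + C². Expanding, the monomials in the relevant
residue class have coefficients divisible by 5.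

Bilateral identities are obtained as coefficientwise limits of finite identities over a field. -/

/-- A family of power series all but finitely many of which are divisible by any given power
of `X`. -/
def Small {ι : Type*} (f : ι → ℤ⟦X⟧) : Prop := ∀ d : ℕ, {i | ¬ X ^ d ∣ f i}.Finite

theorem Small.summable {ι : Type*} {f : ι → ℤ⟦X⟧} (h : Small f) : Summable f := by
  rw [WithPiTopology.summable_iff_summable_coeff]
  intro d
  refine summable_of_hasFiniteSupport ((h (d + 1)).subset fun i hi hd => hi ?_)
  exact X_pow_dvd_iff.mp hd d (Nat.lt_succ_self d)

theorem Small.of_dvd {ι : Type*} {f g : ι → ℤ⟦X⟧} (h : Small f) (hd : ∀ i, f i ∣ g i) :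
    Small g := fun d => (h d).subset fun i hi hf => hi (hf.trans (hd i))

theorem Small.comp_injective {ι κ : Type*} {f : ι → ℤ⟦X⟧} (h : Small f) {g : κ → ι}
    (hg : Function.Injective g) : Small fun k => f (g k) :=
  fun d => (h d).preimage hg.injOn

theorem Small.prod {ι κ : Type*} {f : ι → ℤ⟦X⟧} {g : κ → ℤ⟦X⟧} (hf : Small f) (hg : Small g) :
    Small fun x : ι × κ => f x.1 * g x.2 := fun d =>
  ((hf d).prod (hg d)).subset fun _ hx =>
    ⟨fun h => hx (h.mul_right _), fun h => hx (h.mul_left _)⟩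

theorem Small.of_X_pow_dvd {f : ℤ → ℤ⟦X⟧} (h : ∀ n, X ^ (n.natAbs - 1) ∣ f n) : Small f := by
  intro d
  refine (Set.finite_Icc (-(d + 1 : ℤ)) (d + 1)).subset fun n hn => ?_
  by_contra hc
  refine hn ((pow_dvd_pow X ?_).trans (h n))
  simp only [Set.mem_Icc, not_and_or] at hc
  lia

theorem Small.tsum_mul_tsum {ι κ : Type*} {f : ι → ℤ⟦X⟧} {g : κ → ℤ⟦X⟧} (hf : Small f)
    (hg : Small g) : (∑' i, f i) * ∑' k, g k = ∑' x : ι × κ, f x.1 * g x.2 :=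
  hf.summable.tsum_mul_tsum hg.summable (hf.prod hg).summable

theorem Small.fiber {ι κ : Type*} {f : ι × κ → ℤ⟦X⟧} (hf : Small f) (i : ι) :
    Small fun k => f (i, k) := hf.comp_injective (Prod.mk_right_injective i)

theorem Small.tsum_prod {ι κ : Type*} {f : ι × κ → ℤ⟦X⟧} (hf : Small f) :
    ∑' x, f x = ∑' (i : ι) (k : κ), f (i, k) :=
  hf.summable.tsum_prod' fun i => (hf.fiber i).summable

theorem Small.mul_left {ι : Type*} {f : ι → ℤ⟦X⟧} (hf : Small f) (a : ℤ⟦X⟧) :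
    Small fun i => a * f i := hf.of_dvd fun _ => Dvd.intro_left _ rfl

theorem Small.const_mul_tsum {ι : Type*} {f : ι → ℤ⟦X⟧} (hf : Small f) (a : ℤ⟦X⟧) :
    a * ∑' i, f i = ∑' i, a * f i := (hf.summable.tsum_mul_left a).symm

theorem Small.sum_equiv {ι κ σ : Type*} [Fintype σ] {f : ι → ℤ⟦X⟧} (hf : Small f)
    (e : σ × κ ≃ ι) : ∑' i, f i = ∑ c, ∑' k, f (e (c, k)) := by
  rw [← e.tsum_eq f, (hf.comp_injective e.injective).tsum_prod, tsum_fintype]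

/-- Dominated convergence for families of power series. -/
theorem tendsto_sum_of_small {ι : Type*} {g : ι → ℤ⟦X⟧} (hg : Small g) {u : ℕ → ι → ℤ⟦X⟧}
    {v : ι → ℤ⟦X⟧} (hu : ∀ n i, g i ∣ u n i) (hv : ∀ i, g i ∣ v i)
    (huv : ∀ i, Filter.Tendsto (fun n => u n i) Filter.atTop (nhds (v i))) (s : ℕ → Finset ι)
    (hs : ∀ i, ∀ᶠ n in Filter.atTop, i ∈ s n) :
    Filter.Tendsto (fun n => ∑ i ∈ s n, u n i) Filter.atTop (nhds (∑' i, v i)) := by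
  rw [WithPiTopology.tendsto_iff_coeff_tendsto]
  intro d
  have hfin := hg (d + 1)
  have hc : ∀ x : ℤ⟦X⟧, ∀ i ∉ hfin.toFinset, g i ∣ x → coeff d x = 0 := by
    intro x i hi hx
    simp only [Set.Finite.mem_toFinset, Set.mem_ofPred_eq, not_not] at hi
    exact X_pow_dvd_iff.mp (hi.trans hx) d (Nat.lt_succ_self d)
  have hvs : coeff d (∑' i, v i) = ∑ i ∈ hfin.toFinset, coeff d (v i) := by
    rw [(hg.of_dvd hv).summable.map_tsum _ (WithPiTopology.continuous_coeff ℤ d)]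
    exact tsum_eq_sum fun i hi => hc _ i hi (hv i)
  rw [hvs]
  refine (tendsto_finsetSum hfin.toFinset fun i _ =>
    ((WithPiTopology.tendsto_iff_coeff_tendsto ..).mp (huv i) d)).congr' ?_
  have hsub : ∀ᶠ n in Filter.atTop, hfin.toFinset ⊆ s n := by
    simp only [Finset.subset_iff]
    exact (Filter.eventually_all_finset _).mpr fun i _ => hs i
  filter_upwards [hsub] with n hn
  rw [map_sum]
  exact Finset.sum_subset hn fun i _ hi => hc _ i hi (hu n i)

/-! ### Monomials with integer exponents -/

/-- The monomial `± X ^ a`, for an integer `a` that is meant to be nonnegative. -/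
noncomputable def mon (ε : ℤˣ) (a : ℤ) : ℤ⟦X⟧ := ((ε : ℤ) : ℤ⟦X⟧) * X ^ a.toNat

theorem mon_mul_mon (ε δ : ℤˣ) {a b : ℤ} (ha : 0 ≤ a) (hb : 0 ≤ b) :
    mon ε a * mon δ b = mon (ε * δ) (a + b) := by
  unfold mon
  rw [Int.toNat_add ha hb, pow_add]
  push_cast
  ring

@[simp] theorem mon_zero : mon 1 0 = 1 := by simp [mon]

theorem mon_natCast (ε : ℤˣ) (a : ℕ) : mon ε a = ((ε : ℤ) : ℤ⟦X⟧) * X ^ a := by simp [mon]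

theorem mon_one_natCast (a : ℕ) : mon 1 a = X ^ a := by simp [mon]

theorem mon_neg (ε : ℤˣ) (a : ℤ) : mon (-ε) a = -mon ε a := by simp [mon]

theorem X_pow_dvd_mon (ε : ℤˣ) {a : ℤ} {d : ℕ} (h : d ≤ a) : X ^ d ∣ mon ε a :=
  Dvd.dvd.mul_left (pow_dvd_pow X (by lia)) _

theorem units_zpow_two_mul (ε : ℤˣ) (n : ℤ) : ε ^ (2 * n) = 1 := by
  rw [zpow_mul, zpow_ofNat, Int.units_sq, one_zpow]

/-! ### Theta series -/

/-- `∑ εⁿ q^{r n (n - 1) + k n}`, the theta series `j(-ε q^k; q^{2r})`. -/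
noncomputable def T (r k : ℤ) (ε : ℤˣ) : ℤ⟦X⟧ := ∑' n : ℤ, mon (ε ^ n) (r * (n * (n - 1)) + k * n)

theorem mul_pred_nonneg (n : ℤ) : 0 ≤ n * (n - 1) := by
  rcases le_or_gt n 0 with h | h <;> nlinarith

theorem exponent_nonneg {r k : ℤ} (hk : 0 ≤ k) (hr : k ≤ 2 * r) (n : ℤ) :
    0 ≤ r * (n * (n - 1)) + k * n := by
  rcases le_or_gt n 0 with h | h
  · have h1 : 0 ≤ r * (n * (n + 1)) := by
      have := mul_pred_nonneg (n + 1)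
      rw [add_sub_cancel_right, mul_comm] at this
      exact mul_nonneg (by lia) this
    nlinarith
  · exact add_nonneg (mul_nonneg (by lia) (mul_pred_nonneg n)) (by positivity)

/-- Linear growth is all that summability needs. The loss of one cannot be avoided at the ends of
the range: the exponent vanishes at n = 1 when k = 0 and at n = -1 when k = 2r. -/
theorem natAbs_pred_le_exponent {r k : ℤ} (h0 : 0 < r) (hk : 0 ≤ k) (hr : k ≤ 2 * r) (n : ℤ) :
    ((n.natAbs - 1 : ℕ) : ℤ) ≤ r * (n * (n - 1)) + k * n := by
  rcases lt_trichotomy n 0 with h | rfl | h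
  · have h1 : 1 * (n * (n + 1)) ≤ r * (n * (n + 1)) :=
      mul_le_mul_of_nonneg_right h0 (by nlinarith)
    have h2 : -n - 1 ≤ n * (n + 1) := by nlinarith
    have h3 : 0 ≤ (2 * r - k) * (-n) := mul_nonneg (by lia) (by lia)
    have h4 : -n - 1 ≤ r * (n * (n - 1)) + k * n := by linarith
    lia
  · simp
  · have h1 : 1 * (n * (n - 1)) ≤ r * (n * (n - 1)) :=
      mul_le_mul_of_nonneg_right h0 (by nlinarith)
    have h2 : n - 1 ≤ n * (n - 1) := by nlinarith
    have h3 : 0 ≤ k * n := by positivity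
    have h4 : n - 1 ≤ r * (n * (n - 1)) + k * n := by linarith
    lia

theorem small_mon {r k : ℤ} (h0 : 0 < r) (hk : 0 ≤ k) (hr : k ≤ 2 * r) (ε : ℤ → ℤˣ) :
    Small fun n : ℤ => mon (ε n) (r * (n * (n - 1)) + k * n) :=
  Small.of_X_pow_dvd fun n => X_pow_dvd_mon _ (natAbs_pred_le_exponent h0 hk hr n)

theorem T_reflect (r k : ℤ) (ε : ℤˣ) : T r (2 * r - k) ε = T r k ε := by
  unfold T
  rw [← (Equiv.neg ℤ).tsum_eq]
  refine tsum_congr fun n => ?_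
  simp only [Equiv.neg_apply, zpow_neg, Int.units_inv_eq_self]
  congr 1
  ring

/-- The involution n ↦ 1 - n fixes the exponent and reverses the sign. -/
theorem T_zero_neg_one (r : ℤ) : T r 0 (-1) = 0 := by
  have h : T r 0 (-1) = -T r 0 (-1) := by
    unfold T
    conv_lhs => rw [← (Equiv.subLeft (1 : ℤ)).tsum_eq]
    rw [← tsum_neg]
    refine tsum_congr fun n => ?_
    rw [← mon_neg, Equiv.subLeft_apply]
    congr 1
    · rw [sub_eq_add_neg, zpow_add, zpow_neg, Int.units_inv_eq_self]; simp
    · ring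
  ext n
  have := congrArg (coeff n) h
  rw [map_neg] at this
  rw [map_zero]
  lia

/-- Splitting the pairs of integers according to the parity of their sum. -/
def parityEquiv : Fin 2 × ℤ × ℤ ≃ ℤ × ℤ where
  toFun x := (x.2.1 + x.2.2, x.2.1 - x.2.2 + x.1.val)
  invFun y := (if (y.1 + y.2) % 2 = 0 then 0 else 1, (y.1 + y.2) / 2, (y.1 - y.2 + 1) / 2)
  left_inv := by
    rintro ⟨b, m, n⟩
    fin_cases b <;> simp <;> lia
  right_inv := by
    rintro ⟨m, n⟩
    simp only [Prod.mk.injEq]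
    split_ifs <;> simp <;> lia

/-- The substitution (m + n, m - n) diagonalises the sum of two squares. It reaches only pairs of
even sum, so the odd coset contributes a second product. This is the source of all the three-term
relations below. -/
theorem T_mul_T {r k l : ℤ} (h0 : 0 < r) (hl : 0 ≤ l) (hlk : l ≤ k) (hkl : k + l ≤ 2 * r)
    (s t : ℤˣ) :
    T r k s * T r l t = T (2 * r) (k + l) (s * t) * T (2 * r) (k - l + 2 * r) (s * t) +
      mon t l * T (2 * r) (k + l + 2 * r) (s * t) * T (2 * r) (k - l) (s * t) := by
  have hk : 0 ≤ k := hl.trans hlk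
  have hs := small_mon h0 hk (by lia) (s ^ ·)
  have ht := small_mon h0 hl (by lia) (t ^ ·)
  have hA : ∀ {c : ℤ}, 0 ≤ c → c ≤ 4 * r → Small fun n : ℤ =>
      mon ((s * t) ^ n) (2 * r * (n * (n - 1)) + c * n) := fun h1 h2 =>
    small_mon (by lia) h1 (by lia) ((s * t) ^ ·)
  have e1 := @exponent_nonneg r k hk (by lia)
  have e2 := @exponent_nonneg r l hl (by lia)
  have hst : ∀ m n : ℤ, s ^ (m + n) * t ^ (m - n) = (s * t) ^ m * (s * t) ^ n := by
    intro m n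
    rw [zpow_sub, Int.units_inv_eq_self, zpow_add, mul_zpow, mul_zpow]
    exact mul_mul_mul_comm ..
  unfold T
  rw [hs.tsum_mul_tsum ht, (hs.prod ht).sum_equiv parityEquiv, Fin.sum_univ_two,
    mul_assoc (mon t l), (hA (by lia) (by lia)).tsum_mul_tsum (hA (by lia) (by lia)),
    (hA (by lia) (by lia)).tsum_mul_tsum (hA (by lia) (by lia)),
    ((hA (by lia) (by lia)).prod (hA (by lia) (by lia))).const_mul_tsum]
  congr 1 <;> refine tsum_congr fun x => ?_
  · obtain ⟨m, n⟩ := x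
    simp only [parityEquiv, Equiv.coe_fn_mk, Fin.val_zero, Nat.cast_zero, add_zero]
    rw [mon_mul_mon _ _ (e1 _) (e2 _), mon_mul_mon _ _ (exponent_nonneg (by lia) (by lia) _)
      (exponent_nonneg (by lia) (by lia) _), hst]
    congr 1
    ring
  · obtain ⟨m, n⟩ := x
    simp only [parityEquiv, Equiv.coe_fn_mk, Fin.val_one, Nat.cast_one]
    have h3 := @exponent_nonneg (2 * r) (k + l + 2 * r) (by lia) (by lia) m
    have h4 := @exponent_nonneg (2 * r) (k - l) (by lia) (by lia) n
    rw [mon_mul_mon _ _ (e1 _) (e2 _), mon_mul_mon _ _ h3 h4,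
      mon_mul_mon _ _ hl (add_nonneg h3 h4), zpow_add t, ← hst]
    congr 1
    · rw [zpow_one]
      exact (mul_assoc _ _ _).symm.trans (mul_comm _ _)
    · ring

end AppellLerch

namespace AppellLerch

open PowerSeries
open scoped PowerSeries.WithPiTopology

/-! ### Three-term relations of level ten -/

theorem T_five_mul {k l : ℤ} (hl : 0 ≤ l) (hlk : l ≤ k) (hkl : k + l ≤ 10) :
    T 5 k (-1) * T 5 l (-1) = T 10 (k + l) 1 * T 10 (k - l + 10) 1 -
      X ^ l.toNat * T 10 (k + l + 10) 1 * T 10 (k - l) 1 := by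
  have h := T_mul_T (r := 5) (by norm_num) hl hlk (by lia) (-1) (-1)
  have hm : mon (-1) l = -X ^ l.toNat := by simp [mon]
  rw [hm] at h
  norm_num at h
  rw [h]
  ring

theorem T_ten_reflect (k : ℤ) : T 10 (20 - k) 1 = T 10 k 1 := T_reflect 10 k 1

/-- Each product J_k J_l with k and l of equal parity is a quadratic form in the six series `T 10 j
1`, j = 0, 2, …, 10. Once the factors are grouped into such pairs, the relations are polynomial
identities in these six. -/
theorem T_five_relations :
    X * T 5 1 (-1) ^ 2 * (T 5 2 (-1) * T 5 4 (-1)) + T 5 1 (-1) * T 5 3 (-1) * T 5 4 (-1) ^ 2 =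
        T 5 2 (-1) ^ 2 * (T 5 3 (-1) * T 5 5 (-1)) ∧
      X * (T 5 1 (-1) * T 5 3 (-1)) * T 5 2 (-1) ^ 2 +
        T 5 1 (-1) * T 5 5 (-1) * T 5 4 (-1) ^ 2 =
        T 5 3 (-1) ^ 2 * (T 5 2 (-1) * T 5 4 (-1)) ∧
      X ^ 2 * T 5 1 (-1) ^ 2 * T 5 2 (-1) ^ 2 + T 5 2 (-1) * T 5 4 (-1) * T 5 5 (-1) ^ 2 =
        T 5 3 (-1) ^ 2 * T 5 4 (-1) ^ 2 := by
  have h11 := T_five_mul (k := 1) (l := 1) (by norm_num) (by norm_num) (by norm_num)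
  have h22 := T_five_mul (k := 2) (l := 2) (by norm_num) (by norm_num) (by norm_num)
  have h33 := T_five_mul (k := 3) (l := 3) (by norm_num) (by norm_num) (by norm_num)
  have h44 := T_five_mul (k := 4) (l := 4) (by norm_num) (by norm_num) (by norm_num)
  have h55 := T_five_mul (k := 5) (l := 5) (by norm_num) (by norm_num) (by norm_num)
  have h31 := T_five_mul (k := 3) (l := 1) (by norm_num) (by norm_num) (by norm_num)
  have h51 := T_five_mul (k := 5) (l := 1) (by norm_num) (by norm_num) (by norm_num)
  have h53 := T_five_mul (k := 5) (l := 3) (by norm_num) (by norm_num) (by norm_num)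
  have h42 := T_five_mul (k := 4) (l := 2) (by norm_num) (by norm_num) (by norm_num)
  have r12 := T_ten_reflect 8
  have r14 := T_ten_reflect 6
  have r16 := T_ten_reflect 4
  have r18 := T_ten_reflect 2
  have r20 := T_ten_reflect 0
  norm_num at h11 h22 h33 h44 h55 h31 h51 h53 h42 r12 r14 r16 r18 r20
  simp only [r12, r14, r16, r18, r20, Int.reduceToNat] at h11 h22 h33 h44 h55 h31 h51 h53 h42
  -- The larger index goes first, matching the orientation of the expansions.
  rw [mul_comm (T 5 1 (-1)) (T 5 3 (-1)), mul_comm (T 5 2 (-1)) (T 5 4 (-1)),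
    mul_comm (T 5 3 (-1)) (T 5 5 (-1)), mul_comm (T 5 1 (-1)) (T 5 5 (-1))]
  simp only [pow_two, h11, h22, h33, h44, h55, h31, h51, h53, h42]
  refine ⟨?_, ?_, ?_⟩ <;> ring

/-- A consequence of the three relations after multiplication by J_4. It is the sum of the two
quantities whose difference is found from `phiPsi_sq`. -/
theorem T_five_sextic (h4 : T 5 4 (-1) ≠ 0) :
    T 5 5 (-1) * (X * T 5 4 (-1) ^ 2 * T 5 1 (-1) ^ 3 + T 5 2 (-1) ^ 2 * T 5 3 (-1) ^ 3) =
      T 5 1 (-1) * T 5 2 (-1) * T 5 3 (-1) * T 5 4 (-1) *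
        (T 5 5 (-1) ^ 2 + 2 * (X * T 5 1 (-1) * T 5 3 (-1))) := by
  obtain ⟨r2, r4, r7⟩ := T_five_relations
  refine mul_left_cancel₀ h4 ?_
  linear_combination (-T 5 4 (-1) * T 5 3 (-1) ^ 2) * r2 +
    T 5 1 (-1) * T 5 4 (-1) * (X * T 5 1 (-1) * r4 - T 5 3 (-1) * r7)

end AppellLerch

namespace AppellLerch

open PowerSeries
open scoped PowerSeries.WithPiTopology

/-! ### Dissections -/

/-- Splitting the integers according to parity. -/
def evenOddEquiv : Fin 2 × ℤ ≃ ℤ where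
  toFun x := 2 * x.2 + x.1.val
  invFun n := (if n % 2 = 0 then 0 else 1, n / 2)
  left_inv := by
    rintro ⟨b, m⟩
    fin_cases b
    · simp
    · simp
      lia
  right_inv n := by
    dsimp only
    split_ifs <;> simp <;> lia

theorem T_even_add_odd {r k : ℤ} (h0 : 0 < r) (hk : 0 ≤ k) (hkr : k ≤ r) (ε : ℤˣ) :
    T r k ε = T (4 * r) (2 * r + 2 * k) 1 + mon ε k * T (4 * r) (6 * r + 2 * k) 1 := by
  have hT : ∀ c : ℤ, 0 ≤ c → c ≤ 8 * r → Small fun n : ℤ =>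
      mon (1 ^ n) (4 * r * (n * (n - 1)) + c * n) := fun c h1 h2 =>
    small_mon (by lia) h1 (by lia) (1 ^ ·)
  unfold T
  rw [(small_mon h0 hk (by lia) (ε ^ ·)).sum_equiv evenOddEquiv, Fin.sum_univ_two,
    (hT _ (by lia) (by lia)).const_mul_tsum]
  congr 1 <;> refine tsum_congr fun n => ?_
  · simp only [evenOddEquiv, Equiv.coe_fn_mk, Fin.val_zero, Nat.cast_zero, add_zero,
      units_zpow_two_mul, one_zpow]
    congr 1
    ring
  · rw [mon_mul_mon _ _ hk (exponent_nonneg (by lia) (by lia) n)]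
    simp only [evenOddEquiv, Equiv.coe_fn_mk, Fin.val_one, Nat.cast_one, zpow_add,
      units_zpow_two_mul, one_zpow, zpow_one, one_mul, mul_one]
    congr 1
    ring

theorem T_zero_one {r : ℤ} (h0 : 0 < r) : T r 0 1 = 2 * T (4 * r) (2 * r) 1 := by
  have h := T_even_add_odd h0 le_rfl h0.le 1
  have h2 := T_reflect (4 * r) (2 * r) 1
  rw [show 2 * (4 * r) - 2 * r = 6 * r by ring] at h2
  simp only [mul_zero, add_zero, mon_zero, one_mul] at h
  rw [h, h2]
  ring

/-- Splitting the Gaussian integers into the cosets of the ideal `(2 - i)` with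
representatives `g`. -/
def gaussEquiv (g : Fin 5 → ℤ × ℤ) (hg : ∀ c, ((g c).1 + 2 * (g c).2) % 5 = c) :
    Fin 5 × ℤ × ℤ ≃ ℤ × ℤ where
  toFun x := (2 * x.2.1 + x.2.2 + (g x.1).1, 2 * x.2.2 - x.2.1 + (g x.1).2)
  invFun y :=
    let c : Fin 5 := ⟨((y.1 + 2 * y.2) % 5).toNat, by lia⟩
    (c, (2 * (y.1 - (g c).1) - (y.2 - (g c).2)) / 5,
      ((y.1 - (g c).1) + 2 * (y.2 - (g c).2)) / 5)
  left_inv := by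
    rintro ⟨c, a, b⟩
    have h : (⟨((2 * a + b + (g c).1 + 2 * (2 * b - a + (g c).2)) % 5).toNat,
        by lia⟩ : Fin 5) = c := by
      ext
      have := hg c
      dsimp only
      lia
    dsimp only
    rw [h]
    simp only [Prod.mk.injEq, true_and]
    constructor <;> lia
  right_inv := by
    rintro ⟨m, n⟩
    have := hg ⟨((m + 2 * n) % 5).toNat, by lia⟩
    rw [Int.toNat_of_nonneg (by lia)] at this
    simp only [Prod.mk.injEq]
    generalize (⟨((m + 2 * n) % 5).toNat, by lia⟩ : Fin 5) = c at *
    constructor <;> lia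

/-- Multiplication by a Gaussian integer of norm 5 scales m² + n² by 5, so each of the five cosets
again gives a product of two theta series, of modulus five times as large. The hypothesis `h`
records completion of the exponent on each coset, with offset `d` and new linear coefficients `k'`,
`l'`. Signs separate because the sum of the new coordinates is congruent to a + b, up to the
representative, modulo 2. -/
theorem T_mul_T_gauss {k l : ℤ} {r : ℤ} (h0 : 0 < r) (hk : 0 ≤ k) (hkr : k ≤ 2 * r) (hl : 0 ≤ l)
    (hlr : l ≤ 2 * r) (ε : ℤˣ) (g : Fin 5 → ℤ × ℤ)
    (hg : ∀ c, ((g c).1 + 2 * (g c).2) % 5 = c) (d k' l' : Fin 5 → ℤ) (hd : ∀ c, 0 ≤ d c)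
    (hk' : ∀ c, 0 ≤ k' c) (hkr' : ∀ c, k' c ≤ 10 * r) (hl' : ∀ c, 0 ≤ l' c)
    (hlr' : ∀ c, l' c ≤ 10 * r)
    (h : ∀ c, ∀ a b : ℤ, d c + (5 * r * (a * (a - 1)) + k' c * a) +
        (5 * r * (b * (b - 1)) + l' c * b) =
      r * ((gaussEquiv g hg (c, a, b)).1 * ((gaussEquiv g hg (c, a, b)).1 - 1)) +
        k * (gaussEquiv g hg (c, a, b)).1 +
        (r * ((gaussEquiv g hg (c, a, b)).2 * ((gaussEquiv g hg (c, a, b)).2 - 1)) +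
        l * (gaussEquiv g hg (c, a, b)).2)) :
    T r k ε * T r l ε = ∑ c, mon (ε ^ ((g c).1 + (g c).2)) (d c) *
      T (5 * r) (k' c) ε * T (5 * r) (l' c) ε := by
  have h1 := fun c => small_mon (by lia) (hk' c) (r := 5 * r) (by linarith [hkr' c]) (ε ^ ·)
  have h2 := fun c => small_mon (by lia) (hl' c) (r := 5 * r) (by linarith [hlr' c]) (ε ^ ·)
  unfold T
  rw [(small_mon h0 hk hkr (ε ^ ·)).tsum_mul_tsum (small_mon h0 hl hlr (ε ^ ·)),
    ((small_mon h0 hk hkr (ε ^ ·)).prod (small_mon h0 hl hlr (ε ^ ·))).sum_equiv (gaussEquiv g hg)]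
  refine Finset.sum_congr rfl fun c _ => ?_
  rw [mul_assoc, (h1 c).tsum_mul_tsum (h2 c), ((h1 c).prod (h2 c)).const_mul_tsum]
  refine tsum_congr fun x => ?_
  obtain ⟨a, b⟩ := x
  have e1 := exponent_nonneg (hk' c) (r := 5 * r) (by linarith [hkr' c]) a
  have e2 := exponent_nonneg (hl' c) (r := 5 * r) (by linarith [hlr' c]) b
  dsimp only
  rw [mon_mul_mon _ _ (exponent_nonneg hk hkr _) (exponent_nonneg hl hlr _), ← h,
    mon_mul_mon _ _ e1 e2, mon_mul_mon _ _ (hd c) (add_nonneg e1 e2), ← zpow_add, ← zpow_add,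
    ← zpow_add, add_assoc (d c)]
  congr 1
  have : (gaussEquiv g hg (c, a, b)).1 + (gaussEquiv g hg (c, a, b)).2 =
      (g c).1 + (g c).2 + (a + b) + 2 * b := by
    simp only [gaussEquiv, Equiv.coe_fn_mk]
    ring
  rw [this, zpow_add _ _ (2 * b), units_zpow_two_mul, mul_one]

/-- The representatives are 0 and the four units of the Gaussian integers. By reflection the four
unit cosets contribute the same product. -/
theorem T_one_one_sq (ε : ℤˣ) :
    T 1 1 ε ^ 2 = T 5 5 ε ^ 2 + 4 * (mon ε 1 * T 5 1 ε * T 5 3 ε) := by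
  have h := T_mul_T_gauss (k := 1) (l := 1) (r := 1) one_pos (by norm_num) (by norm_num)
    (by norm_num) (by norm_num) ε ![(0, 0), (1, 0), (0, 1), (0, -1), (-1, 0)]
    (by simp [Fin.forall_fin_succ]) ![0, 1, 1, 1, 1] ![5, 9, 3, 7, 1] ![5, 7, 9, 1, 3]
    (by simp [Fin.forall_fin_succ]) (by simp [Fin.forall_fin_succ])
    (by simp [Fin.forall_fin_succ]) (by simp [Fin.forall_fin_succ])
    (by simp [Fin.forall_fin_succ])
    (by
      intro c a b
      fin_cases c <;> simp [gaussEquiv] <;> ring)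
  have r1 : T 5 9 ε = T 5 1 ε := T_reflect 5 1 ε
  have r3 : T 5 7 ε = T 5 3 ε := T_reflect 5 3 ε
  rw [pow_two, h, Fin.sum_univ_five]
  simp [r1, r3]
  ring

/-- This is ψ(q²)² = q² ψ(q¹⁰)² + f(q²,q⁸) f(q⁴,q⁶). One factor is first reflected to `T 4 6 1`. The
coset of (-1, 0) gives the square, and the other four are the terms of the product of the even-odd
splittings of `T 5 2 1` and `T 5 4 1`. -/
theorem T_four_two_sq :
    T 4 2 1 ^ 2 = X ^ 2 * T 20 10 1 ^ 2 + T 5 2 1 * T 5 4 1 := by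
  have h := T_mul_T_gauss (k := 6) (l := 2) (r := 4) (by norm_num) (by norm_num) (by norm_num)
    (by norm_num) (by norm_num) 1 ![(0, 0), (-1, 1), (0, 1), (0, -1), (-1, 0)]
    (by simp [Fin.forall_fin_succ]) ![0, 4, 2, 6, 2] ![26, 2, 18, 34, 10] ![18, 26, 34, 2, 10]
    (by simp [Fin.forall_fin_succ]) (by simp [Fin.forall_fin_succ])
    (by simp [Fin.forall_fin_succ]) (by simp [Fin.forall_fin_succ])
    (by simp [Fin.forall_fin_succ])
    (by
      intro c a b
      fin_cases c <;> simp [gaussEquiv] <;> ring)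
  have r0 : T 4 6 1 = T 4 2 1 := T_reflect 4 2 1
  have r1 : T 20 38 1 = T 20 2 1 := T_reflect 20 2 1
  have h2 := T_even_add_odd (r := 5) (k := 2) (by norm_num) (by norm_num) (by norm_num) 1
  have h4 := T_even_add_odd (r := 5) (k := 4) (by norm_num) (by norm_num) (by norm_num) 1
  have r3 : T 20 26 1 = T 20 14 1 := T_reflect 20 14 1
  norm_num at h2 h4
  rw [h2, h4, r1, pow_two]
  nth_rw 1 [← r0]
  rw [h, Fin.sum_univ_five]
  simp [r3, mon]
  ring

end AppellLerch

namespace AppellLerch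

/-! ### Gaussian binomial coefficients -/

section GaussBinom

variable {A : Type*} [CommRing A]

/-- The Gaussian binomial coefficients. -/
def gaussBinom (Q : A) : ℕ → ℕ → A
  | _, 0 => 1
  | 0, _ + 1 => 0
  | n + 1, k + 1 => Q ^ (k + 1) * gaussBinom Q n (k + 1) + gaussBinom Q n k

/-- `(Q; Q)_n`. -/
def qFactorial (Q : A) (n : ℕ) : A := ∏ i ∈ Finset.range n, (1 - Q ^ (i + 1))

theorem qFactorial_succ (Q : A) (n : ℕ) :
    qFactorial Q (n + 1) = qFactorial Q n * (1 - Q ^ (n + 1)) := Finset.prod_range_succ ..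

@[simp] theorem gaussBinom_zero_right (Q : A) (n : ℕ) : gaussBinom Q n 0 = 1 := by
  cases n <;> rfl

theorem gaussBinom_succ_succ (Q : A) (n k : ℕ) :
    gaussBinom Q (n + 1) (k + 1) = Q ^ (k + 1) * gaussBinom Q n (k + 1) + gaussBinom Q n k := rfl

theorem gaussBinom_eq_zero (Q : A) {n k : ℕ} (h : n < k) : gaussBinom Q n k = 0 := by
  induction n generalizing k with
  | zero => cases k with
    | zero => exact absurd h (lt_irrefl _)
    | succ k => rfl
  | succ n ih => cases k with
    | zero => exact absurd h (by lia)
    | succ k => rw [gaussBinom_succ_succ, ih (by lia), ih (by lia), mul_zero, add_zero]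

theorem map_gaussBinom {B : Type*} [CommRing B] (f : A →+* B) (Q : A) (n k : ℕ) :
    f (gaussBinom Q n k) = gaussBinom (f Q) n k := by
  induction n generalizing k with
  | zero => cases k <;> simp [gaussBinom]
  | succ n ih => cases k <;> simp [gaussBinom, ih]

theorem map_qFactorial {B : Type*} [CommRing B] (f : A →+* B) (Q : A) (n : ℕ) :
    f (qFactorial Q n) = qFactorial (f Q) n := by
  simp [qFactorial]

theorem gaussBinom_self (Q : A) (n : ℕ) : gaussBinom Q n n = 1 := by
  induction n with
  | zero => rfl
  | succ n ih => rw [gaussBinom_succ_succ, gaussBinom_eq_zero Q (Nat.lt_succ_self n), ih]; ring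

theorem gaussBinom_mul_qFactorial (Q : A) (n : ℕ) : ∀ a b : ℕ, a + b = n →
    gaussBinom Q n a * (qFactorial Q a * qFactorial Q b) = qFactorial Q n := by
  induction n with
  | zero =>
    intro a b h
    obtain ⟨rfl, rfl⟩ : a = 0 ∧ b = 0 := by lia
    simp [qFactorial]
  | succ n ih =>
    intro a b h
    rcases a with _ | a
    · obtain rfl : b = n + 1 := by lia
      simp [qFactorial]
    rcases b with _ | b
    · obtain rfl : a = n := by lia
      simp [gaussBinom_self, qFactorial]
    have h1 := ih (a + 1) b (by lia)
    have h2 := ih a (b + 1) (by lia)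
    obtain rfl : n = a + b + 1 := by lia
    rw [gaussBinom_succ_succ]
    rw [qFactorial_succ Q a] at h1 ⊢
    rw [qFactorial_succ Q b] at h2 ⊢
    rw [qFactorial_succ Q (a + b + 1)]
    linear_combination Q ^ (a + 1) * (1 - Q ^ (b + 1)) * h1 + (1 - Q ^ (a + 1)) * h2

/-- The q-binomial theorem. Removing the factor i = 0 replaces t by tQ, and the recursion for
Gaussian binomials matches coefficients. -/
theorem prod_one_add_mul_pow (Q t : A) (M : ℕ) :
    ∏ i ∈ Finset.range M, (1 + t * Q ^ i) =
      ∑ i ∈ Finset.range (M + 1), Q ^ (i.choose 2) * gaussBinom Q M i * t ^ i := by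
  induction M generalizing t with
  | zero => simp
  | succ M ih =>
    have h : ∀ i, 1 + t * Q ^ (i + 1) = 1 + (t * Q) * Q ^ i := fun i => by ring
    rw [Finset.prod_range_succ', Finset.prod_congr rfl fun i _ => h i, ih,
      Finset.sum_range_succ' _ (M + 1)]
    simp only [gaussBinom_succ_succ, gaussBinom_zero_right]
    have h2 : ∀ i, Q ^ ((i + 1).choose 2) * (Q ^ (i + 1) * gaussBinom Q M (i + 1) +
        gaussBinom Q M i) * t ^ (i + 1) =
        Q ^ ((i + 1).choose 2) * gaussBinom Q M (i + 1) * (t * Q) ^ (i + 1) +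
        t * (Q ^ (i.choose 2) * gaussBinom Q M i * (t * Q) ^ i) := by
      intro i
      rw [Nat.choose_succ_succ' i 1, Nat.choose_one_right]
      ring
    simp only [h2, Finset.sum_add_distrib, ← Finset.mul_sum]
    have h3 := Finset.sum_range_succ'
      (fun i => Q ^ (i.choose 2) * gaussBinom Q M i * (t * Q) ^ i) (M + 1)
    rw [Finset.sum_range_succ, gaussBinom_eq_zero Q (Nat.lt_succ_self M)] at h3
    simp only [mul_zero, zero_mul, add_zero, gaussBinom_zero_right] at h3
    simp only [pow_zero, mul_one] at h3 ⊢
    linear_combination h3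

end GaussBinom

/-! ### Partial fractions of y^j / ∏ (1 - y Q^i) -/

section PartialFractions

variable {K : Type*} [Field K]

/-- Partial fractions with the largest numerator degree allowed. The Pascal recursion writes the sum
for M + 1 at y as the sum for M at y minus Q^{-M} times the sum for M at yQ. -/
theorem sum_gaussBinom_div_self {Q : K} (hQ : Q ≠ 0) (M : ℕ) (y : K)
    (hy : ∀ i : ℕ, 1 - y * Q ^ i ≠ 0) :
    ∑ i ∈ Finset.range (M + 1), (-1) ^ i * gaussBinom Q M i * Q ^ ((i + 1).choose 2) *
        (Q ^ (i * M))⁻¹ / (1 - y * Q ^ i) =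
      y ^ M * qFactorial Q M / ∏ i ∈ Finset.range (M + 1), (1 - y * Q ^ i) := by
  induction M generalizing y with
  | zero => simp [qFactorial]
  | succ M ih =>
    have hy' : ∀ i : ℕ, 1 - y * Q * Q ^ i ≠ 0 := fun i => by
      have := hy (i + 1)
      rwa [pow_succ', ← mul_assoc] at this
    have i1 := ih y hy
    have i2 := ih (y * Q) hy'
    have e : ∀ i : ℕ, (-1) ^ (i + 1) * gaussBinom Q (M + 1) (i + 1) *
        Q ^ ((i + 1 + 1).choose 2) * (Q ^ ((i + 1) * (M + 1)))⁻¹ / (1 - y * Q ^ (i + 1)) =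
        (-1) ^ (i + 1) * gaussBinom Q M (i + 1) * Q ^ ((i + 1 + 1).choose 2) *
        (Q ^ ((i + 1) * M))⁻¹ / (1 - y * Q ^ (i + 1)) - (Q ^ M)⁻¹ *
        ((-1) ^ i * gaussBinom Q M i * Q ^ ((i + 1).choose 2) * (Q ^ (i * M))⁻¹ /
          (1 - y * Q * Q ^ i)) := by
      intro i
      have a1 := hy (i + 1)
      have a2 := hy' i
      have a3 : 1 - y * Q * Q ^ i = 1 - y * Q ^ (i + 1) := by ring
      rw [gaussBinom_succ_succ, Nat.choose_succ_succ' (i + 1) 1, Nat.choose_one_right, a3]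
      field_simp
      ring
    rw [Finset.sum_range_succ', Finset.sum_congr rfl fun i _ => e i, Finset.sum_sub_distrib,
      ← Finset.mul_sum, i2]
    have h3 := Finset.sum_range_succ' (fun i => (-1) ^ i * gaussBinom Q M i *
      Q ^ ((i + 1).choose 2) * (Q ^ (i * M))⁻¹ / (1 - y * Q ^ i)) (M + 1)
    rw [Finset.sum_range_succ, gaussBinom_eq_zero Q (Nat.lt_succ_self M), i1] at h3
    simp only [mul_zero, zero_mul, zero_div, add_zero, gaussBinom_zero_right, pow_zero, mul_one]
      at h3 ⊢
    have h4 : ∏ i ∈ Finset.range (M + 1), (1 - y * Q * Q ^ i) =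
        ∏ i ∈ Finset.range (M + 1), (1 - y * Q ^ (i + 1)) :=
      Finset.prod_congr rfl fun i _ => by ring
    have p1 := Finset.prod_range_succ' (fun i => 1 - y * Q ^ i) (M + 1)
    have p2 := Finset.prod_range_succ (fun i => 1 - y * Q ^ i) (M + 1)
    have n1 : ∏ i ∈ Finset.range (M + 1), (1 - y * Q ^ i) ≠ 0 :=
      Finset.prod_ne_zero_iff.mpr fun i _ => hy i
    have n2 : ∏ i ∈ Finset.range (M + 1), (1 - y * Q ^ (i + 1)) ≠ 0 :=
      Finset.prod_ne_zero_iff.mpr fun i _ => hy _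
    have n3 := hy (M + 1)
    have n4 := hy 0
    rw [p2] at p1
    rw [h4, qFactorial_succ, p2]
    have h5 : ∀ S T c : K, S = T + c → T - (Q ^ M)⁻¹ * ((y * Q) ^ M * qFactorial Q M /
        ∏ i ∈ Finset.range (M + 1), (1 - y * Q ^ (i + 1))) + c =
        S - y ^ M * qFactorial Q M / ∏ i ∈ Finset.range (M + 1), (1 - y * Q ^ (i + 1)) := by
      intro S T c h
      rw [h, mul_pow]
      field_simp
      ring
    rw [h5 _ _ _ h3]
    rw [div_sub_div _ _ n1 n2, div_eq_div_iff (mul_ne_zero n1 n2) (mul_ne_zero n1 n3)]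
    simp only [pow_zero, mul_one] at p1 n4
    generalize ∏ i ∈ Finset.range (M + 1), (1 - y * Q ^ i) = a at *
    generalize ∏ i ∈ Finset.range (M + 1), (1 - y * Q ^ (i + 1)) = b at *
    linear_combination (y ^ M * qFactorial Q M * a) * (-p1)

/-- Descent from j = M: since y/(1 - yQ^i) = Q^{-i}(1/(1 - yQ^i) - 1), multiplying the sum for j by
y gives the sum for j + 1, up to a sum free of y that vanishes. -/
theorem sum_gaussBinom_div {Q : K} (hQ : Q ≠ 0) (M : ℕ) {y : K} (hy0 : y ≠ 0)
    (hy : ∀ i : ℕ, 1 - y * Q ^ i ≠ 0) (j l : ℕ) (hjl : j + l = M) :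
    ∑ i ∈ Finset.range (M + 1), (-1) ^ i * gaussBinom Q M i * Q ^ ((i + 1).choose 2) *
        (Q ^ (i * j))⁻¹ / (1 - y * Q ^ i) =
      y ^ j * qFactorial Q M / ∏ i ∈ Finset.range (M + 1), (1 - y * Q ^ i) := by
  induction l generalizing j with
  | zero =>
    obtain rfl : j = M := by lia
    exact sum_gaussBinom_div_self hQ j y hy
  | succ l ih =>
    have h := ih (j + 1) (by lia)
    have hz : ∑ i ∈ Finset.range (M + 1), (-1) ^ i * gaussBinom Q M i *
        Q ^ ((i + 1).choose 2) * (Q ^ (i * (j + 1)))⁻¹ = 0 := by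
      -- At t = -Q^{-j} the factor with index j < M of the q-binomial product is zero.
      have h1 := prod_one_add_mul_pow Q (-(Q ^ j)⁻¹) M
      rw [Finset.prod_eq_zero (Finset.mem_range.mpr (show j < M by lia))
        (by field_simp; ring)] at h1
      rw [h1]
      refine Finset.sum_congr rfl fun i _ => ?_
      rw [Nat.choose_succ_succ' i 1, Nat.choose_one_right, neg_pow (Q ^ j)⁻¹, inv_pow, ← pow_mul,
        mul_comm j i]
      field_simp
      ring
    refine mul_left_cancel₀ hy0 ?_
    rw [Finset.mul_sum, ← add_zero (∑ i ∈ Finset.range (M + 1), y * _)]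
    nth_rw 1 [← hz]
    rw [← Finset.sum_add_distrib]
    refine (Finset.sum_congr rfl fun i _ => ?_).trans (h.trans (by ring))
    have := hy i
    field_simp
    ring

end PartialFractions

end AppellLerch

namespace AppellLerch

open PowerSeries Filter Topology
open scoped PowerSeries.WithPiTopology

/-! ### Symmetric finite forms -/

section Symmetric

variable {K : Type*} [Field K]

theorem two_mul_choose_two (i : ℕ) : (2 * (i.choose 2 : ℕ) : ℤ) = i * (i - 1) := by
  have h := Nat.triangle_succ (i - 1)
  rcases i with _ | i
  · simp
  · have h1 := Finset.sum_range_id_mul_two (i + 1)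
    rw [Finset.sum_range_id, ← Nat.choose_two_right] at h1
    rw [add_tsub_cancel_right] at h1
    push_cast
    have h2 : (((i + 1).choose 2 * 2 : ℕ) : ℤ) = ((i + 1) * i : ℕ) := by exact_mod_cast h1
    push_cast at h2
    linarith

/-- In the first half of the factors the monomial w Q^{-i} is pulled out, with Q = x², which turns w
into its inverse and makes the product symmetric. -/
theorem prod_range_two_mul {x w : K} (hx : x ≠ 0) (hw : w ≠ 0) (N : ℕ) :
    ∏ i ∈ Finset.range (2 * N), (1 + w * ((x ^ 2) ^ N)⁻¹ * (x ^ 2) ^ i) =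
      w ^ N * (x ^ (N * (N + 1)))⁻¹ * ((∏ i ∈ Finset.range N, (1 + w * (x ^ 2) ^ i)) *
        ∏ i ∈ Finset.range N, (1 + w⁻¹ * (x ^ 2) ^ (i + 1))) := by
  have h1 : ∏ i ∈ Finset.range N, (1 + w * ((x ^ 2) ^ N)⁻¹ * (x ^ 2) ^ i) =
      w ^ N * (x ^ (N * (N + 1)))⁻¹ * ∏ i ∈ Finset.range N, (1 + w⁻¹ * (x ^ 2) ^ (i + 1)) := by
    have h2 : w ^ N * (x ^ (N * (N + 1)))⁻¹ =
        ∏ i ∈ Finset.range N, (w * ((x ^ 2) ^ (i + 1))⁻¹) := by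
      have hs : ∀ N, 2 * ∑ i ∈ Finset.range N, (i + 1) = N * (N + 1) := by
        intro N
        induction N with
        | zero => simp
        | succ N ih =>
          rw [Finset.sum_range_succ, mul_add, ih]
          ring
      rw [Finset.prod_mul_distrib, Finset.prod_const, Finset.card_range, Finset.prod_inv_distrib,
        Finset.prod_pow_eq_pow_sum, ← pow_mul, hs]
    rw [h2, ← Finset.prod_mul_distrib, ← Finset.prod_range_reflect]
    refine Finset.prod_congr rfl fun i hi => ?_
    have hi' := Finset.mem_range.mp hi
    have h3 : (x ^ 2) ^ N = (x ^ 2) ^ (N - 1 - i) * (x ^ 2) ^ (i + 1) := by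
      rw [← pow_add]
      congr 1
      lia
    rw [h3]
    field_simp
    ring
  rw [two_mul, Finset.prod_range_add, h1]
  have h4 : ∏ i ∈ Finset.range N, (1 + w * ((x ^ 2) ^ N)⁻¹ * (x ^ 2) ^ (N + i)) =
      ∏ i ∈ Finset.range N, (1 + w * (x ^ 2) ^ i) := by
    refine Finset.prod_congr rfl fun i _ => ?_
    rw [pow_add]
    field_simp
  rw [h4]
  ring

/-- The q-binomial theorem of order 2N at t = w Q^{-N}, with the index recentred at N. The base is a
square so that the exponents n(n-1)/2 become integral powers of x. -/
theorem finite_triple_product {x w : K} (hx : x ≠ 0) (hw : w ≠ 0) (N : ℕ) :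
    (∏ i ∈ Finset.range N, (1 + w * (x ^ 2) ^ i)) *
        ∏ i ∈ Finset.range N, (1 + w⁻¹ * (x ^ 2) ^ (i + 1)) =
      ∑ i ∈ Finset.range (2 * N + 1), gaussBinom (x ^ 2) (2 * N) i *
        (x ^ (((i : ℤ) - N) * (((i : ℤ) - N) - 1)) * w ^ ((i : ℤ) - N)) := by
  have h := prod_one_add_mul_pow (x ^ 2) (w * ((x ^ 2) ^ N)⁻¹) (2 * N)
  rw [prod_range_two_mul hx hw] at h
  have hc : w ^ N * (x ^ (N * (N + 1)))⁻¹ ≠ 0 := by positivity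
  refine mul_left_cancel₀ hc ?_
  rw [h, Finset.mul_sum]
  refine Finset.sum_congr rfl fun i _ => ?_
  have h1 : (x ^ 2) ^ (i.choose 2) = x ^ ((i : ℤ) * (i - 1)) := by
    rw [← pow_mul, ← two_mul_choose_two, ← zpow_natCast]
    push_cast
    rfl
  have h2 : ((x ^ 2) ^ N)⁻¹ ^ i = x ^ (-(2 * N * i : ℤ)) := by
    rw [zpow_neg, inv_pow, ← pow_mul, ← pow_mul, ← zpow_natCast]
    push_cast
    rw [mul_assoc]
  have h3 : (x ^ (N * (N + 1)))⁻¹ = x ^ (-(N * (N + 1) : ℤ)) := by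
    rw [zpow_neg, ← zpow_natCast]
    push_cast
    rfl
  rw [mul_pow, h1, h2, h3, zpow_sub₀ hw, zpow_natCast, zpow_natCast]
  have h4 : x ^ (((i : ℤ) - N) * (((i : ℤ) - N) - 1)) =
      x ^ ((i : ℤ) * (i - 1)) * x ^ (-(2 * N * i : ℤ)) * x ^ (N * (N + 1) : ℤ) := by
    rw [← zpow_add₀ hx, ← zpow_add₀ hx]
    congr 1
    ring
  have h5 : x ^ (-(N * (N + 1) : ℤ)) * x ^ (N * (N + 1) : ℤ) = 1 := by
    rw [← zpow_add₀ hx, neg_add_cancel, zpow_zero]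
  have h6 : w ^ N * (w ^ i / w ^ N) = w ^ i := mul_div_cancel₀ _ (pow_ne_zero N hw)
  rw [h4]
  generalize w ^ i / w ^ N = q at *
  linear_combination (-(x ^ ((i : ℤ) * (i - 1)) * gaussBinom (x ^ 2) (2 * N) i *
    x ^ (-(2 * N * i : ℤ)))) * (x ^ (-(N * (N + 1) : ℤ)) * x ^ (N * (N + 1) : ℤ) * h6 + w ^ i * h5)

/-- `sum_gaussBinom_div` of order 2N with j = N, at y = z Q^{-N}. There are 2N + 1 poles but only 2N
factors in the symmetric product, whence the extra factor 1 - z Q^N. -/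
theorem finite_partial_fractions {x z : K} (hx : x ≠ 0) (hz : z ≠ 0)
    (h : ∀ n : ℤ, 1 - z * x ^ (2 * n) ≠ 0) (N : ℕ) :
    ((∏ i ∈ Finset.range N, (1 + -z * (x ^ 2) ^ i)) *
        ∏ i ∈ Finset.range N, (1 + (-z)⁻¹ * (x ^ 2) ^ (i + 1))) * (1 - z * (x ^ 2) ^ N) *
      ∑ i ∈ Finset.range (2 * N + 1), gaussBinom (x ^ 2) (2 * N) i * ((-1) ^ ((i : ℤ) - N) *
        x ^ (((i : ℤ) - N) * (((i : ℤ) - N) + 1)) * (1 - z * x ^ (2 * ((i : ℤ) - N)))⁻¹) =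
      qFactorial (x ^ 2) (2 * N) := by
  have hx2 : x ^ 2 ≠ 0 := pow_ne_zero 2 hx
  have e : ∀ i : ℕ, 1 - z * x ^ (2 * ((i : ℤ) - N)) = 1 - z * ((x ^ 2) ^ N)⁻¹ * (x ^ 2) ^ i := by
    intro i
    rw [mul_sub, zpow_sub₀ hx, zpow_mul, zpow_mul, zpow_natCast, zpow_natCast]
    norm_cast
    field_simp
  have h1 := sum_gaussBinom_div hx2 (2 * N) (y := z * ((x ^ 2) ^ N)⁻¹) (by positivity)
    (fun i => e i ▸ h _) N N (by lia)
  have h2 := prod_range_two_mul hx (neg_ne_zero.mpr hz) N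
  have e3 : ∀ i, 1 + -z * ((x ^ 2) ^ N)⁻¹ * (x ^ 2) ^ i = 1 - z * ((x ^ 2) ^ N)⁻¹ * (x ^ 2) ^ i :=
    fun i => by ring
  have e4 : z * ((x ^ 2) ^ N)⁻¹ * (x ^ 2) ^ (2 * N) = z * (x ^ 2) ^ N := by
    rw [two_mul, pow_add]
    field_simp
  rw [Finset.prod_congr rfl fun i _ => e3 i] at h2
  have hne : ∏ i ∈ Finset.range (2 * N + 1), (1 - z * ((x ^ 2) ^ N)⁻¹ * (x ^ 2) ^ i) ≠ 0 :=
    Finset.prod_ne_zero_iff.mpr fun i _ => e i ▸ h _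
  rw [eq_div_iff hne, Finset.prod_range_succ, h2, e4] at h1
  have hc : (z * ((x ^ 2) ^ N)⁻¹) ^ N ≠ 0 := by positivity
  refine mul_left_cancel₀ hc ?_
  rw [← h1, Finset.sum_mul, Finset.mul_sum, Finset.mul_sum]
  refine Finset.sum_congr rfl fun i _ => ?_
  rw [e i]
  have h3 : (x ^ 2) ^ ((i + 1).choose 2) = x ^ ((i : ℤ) * (i + 1)) := by
    have := two_mul_choose_two (i + 1)
    push_cast at this
    rw [← pow_mul, ← zpow_natCast]
    push_cast
    rw [this]
    congr 1
    ring
  have h4 : ((x ^ 2) ^ (i * N))⁻¹ = x ^ (-(2 * N * i : ℤ)) := by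
    rw [zpow_neg, ← pow_mul, ← zpow_natCast]
    push_cast
    congr 2
    ring
  have h5 : (x ^ (N * (N + 1)))⁻¹ = x ^ (-(N * (N + 1) : ℤ)) := by
    rw [zpow_neg, ← zpow_natCast]
    push_cast
    rfl
  have h6 : (((x ^ 2) ^ N)⁻¹) ^ N = x ^ (-(2 * N * N : ℤ)) := by
    rw [zpow_neg, inv_pow, ← pow_mul, ← pow_mul, ← zpow_natCast]
    push_cast
    rw [mul_assoc]
  have h7 : x ^ (((i : ℤ) - N) * (((i : ℤ) - N) + 1)) * x ^ (-(2 * N * N : ℤ)) =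
      x ^ ((i : ℤ) * (i + 1)) * x ^ (-(2 * N * i : ℤ)) * x ^ (-(N * (N + 1) : ℤ)) := by
    rw [← zpow_add₀ hx, ← zpow_add₀ hx, ← zpow_add₀ hx]
    congr 1
    ring
  have h8 : (-1 : K) ^ ((i : ℤ) - N) = (-1) ^ i * (-1) ^ N := by
    rw [zpow_sub₀ (by norm_num), zpow_natCast, zpow_natCast, div_eq_mul_inv, ← inv_pow]
    norm_num
  rw [mul_pow, h6, h8, h3, h4, h5, neg_pow z, div_eq_mul_inv]
  linear_combination (z ^ N * (-1) ^ i * (-1) ^ N * gaussBinom (x ^ 2) (2 * N) i *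
    (1 - z * ((x ^ 2) ^ N)⁻¹ * (x ^ 2) ^ i)⁻¹ * (1 - z * (x ^ 2) ^ N) *
    ((∏ i ∈ Finset.range N, (1 + -z * (x ^ 2) ^ i)) *
      ∏ i ∈ Finset.range N, (1 + (-z)⁻¹ * (x ^ 2) ^ (i + 1)))) * h7

end Symmetric

end AppellLerch

namespace AppellLerch

open PowerSeries Filter Topology
open scoped PowerSeries.WithPiTopology

/-! ### The triple product and the reciprocal of a theta series -/

theorem tendsto_iff_X_pow_dvd {ι : Type*} {l : Filter ι} {u : ι → ℤ⟦X⟧} {v : ℤ⟦X⟧} :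
    Tendsto u l (𝓝 v) ↔ ∀ d : ℕ, ∀ᶠ n in l, X ^ d ∣ u n - v := by
  rw [WithPiTopology.tendsto_iff_coeff_tendsto]
  simp only [nhds_discrete, tendsto_pure]
  constructor
  · intro h d
    have : ∀ᶠ n in l, ∀ i ∈ Finset.range d, coeff i (u n) = coeff i v :=
      (Filter.eventually_all_finset _).mpr fun i _ => h i
    filter_upwards [this] with n hn
    rw [X_pow_dvd_iff]
    intro i hi
    rw [map_sub, hn i (Finset.mem_range.mpr hi), sub_self]
  · intro h d
    filter_upwards [h (d + 1)] with n hn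
    have := X_pow_dvd_iff.mp hn d (Nat.lt_succ_self d)
    rwa [map_sub, sub_eq_zero] at this

theorem tendsto_prod_qPochInf (a : ℤ⟦X⟧) {u : ℤ⟦X⟧} (hu : constantCoeff u = 0) :
    Tendsto (fun N => ∏ i ∈ Finset.range N, (1 - a * u ^ i)) atTop (𝓝 (qPochInf a u)) :=
  (multipliable_qPochInf a hu).tendsto_prod_tprod_nat

theorem tendsto_qFactorial {q : ℤ⟦X⟧} (hq : constantCoeff q = 0) :
    Tendsto (qFactorial q) atTop (𝓝 (qPochInf q q)) := by
  refine (tendsto_prod_qPochInf q hq).congr fun N => ?_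
  exact Finset.prod_congr rfl fun i _ => by rw [pow_succ']

theorem isUnit_qPochInf {a u : ℤ⟦X⟧} (ha : constantCoeff a = 0) (hu : constantCoeff u = 0) :
    IsUnit (qPochInf a u) := isUnit_of_constantCoeff_eq_one (constantCoeff_qPochInf ha hu)

/-- The Gaussian binomial is (q;q)_{2N} / ((q;q)_{N+n} (q;q)_{N-n}), and all three factorials tend
to (q;q)_∞. -/
theorem tendsto_gaussBinom {q : ℤ⟦X⟧} (hq : constantCoeff q = 0) (n : ℤ) :
    Tendsto (fun N : ℕ => qPochInf q q * gaussBinom q (2 * N) (n + N).toNat) atTop (𝓝 1) := by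
  rw [tendsto_iff_X_pow_dvd]
  intro d
  have h := tendsto_qFactorial hq
  have t1 : Tendsto (fun N : ℕ => (n + N).toNat) atTop atTop :=
    tendsto_atTop.mpr fun b => eventually_atTop.mpr ⟨b + n.natAbs, fun N hN => by lia⟩
  have t2 : Tendsto (fun N : ℕ => (N - n).toNat) atTop atTop :=
    tendsto_atTop.mpr fun b => eventually_atTop.mpr ⟨b + n.natAbs, fun N hN => by lia⟩
  have t3 : Tendsto (fun N : ℕ => 2 * N) atTop atTop :=
    tendsto_atTop.mpr fun b => eventually_atTop.mpr ⟨b, fun N hN => by lia⟩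
  rw [tendsto_iff_X_pow_dvd] at h
  filter_upwards [t1.eventually (h d), t2.eventually (h d), t3.eventually (h d),
    eventually_ge_atTop n.natAbs] with N h1 h2 h3 hN
  have hg := gaussBinom_mul_qFactorial q (2 * N) (n + N).toNat (N - n).toNat (by lia)
  have hu := isUnit_qPochInf hq hq
  set E := qPochInf q q
  set G := gaussBinom q (2 * N) (n + N).toNat
  set A := qFactorial q (n + N).toNat
  set B := qFactorial q (N - n).toNat
  set C := qFactorial q (2 * N)
  -- The error is a combination of the three differences of factorials from their limit, so
  -- divisibility by X^d passes to it.
  have key : E * G - 1 = Ring.inverse E * ((C - E) - G * A * (B - E) - G * E * (A - E)) := by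
    have he : Ring.inverse E * E = 1 := Ring.inverse_mul_cancel _ hu
    linear_combination Ring.inverse E * hg + (1 - E * G) * he
  rw [key]
  exact ((h3.sub (h2.mul_left _)).sub (h1.mul_left _)).mul_left _

theorem sum_range_eq_sum_Icc {M : Type*} [AddCommMonoid M] (F : ℕ → ℤ → M) (N : ℕ) :
    ∑ i ∈ Finset.range (2 * N + 1), F i ((i : ℤ) - N) =
      ∑ n ∈ Finset.Icc (-N : ℤ) N, F (n + N).toNat n := by
  refine Finset.sum_nbij' (fun i => (i : ℤ) - N) (fun n => (n + N).toNat) ?_ ?_ ?_ ?_ ?_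
  · intro i hi
    simp only [Finset.mem_range, Finset.mem_Icc] at hi ⊢
    lia
  · intro i hi
    simp only [Finset.mem_range, Finset.mem_Icc] at hi ⊢
    lia
  · intro i _
    simp
  · intro n hn
    simp only [Finset.mem_Icc] at hn
    lia
  · intro i _
    simp

theorem algebraMap_mon (ε : ℤˣ) {a : ℤ} (ha : 0 ≤ a) :
    algebraMap ℤ⟦X⟧ (FractionRing ℤ⟦X⟧) (mon ε a) =
      ((ε : ℤ) : FractionRing ℤ⟦X⟧) * algebraMap ℤ⟦X⟧ (FractionRing ℤ⟦X⟧) X ^ a := by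
  obtain ⟨n, rfl⟩ := Int.eq_ofNat_of_zero_le ha
  simp [mon]

theorem algebraMap_X_ne_zero : algebraMap ℤ⟦X⟧ (FractionRing ℤ⟦X⟧) X ≠ 0 := by
  simp

theorem units_cast_ne_zero {K : Type*} [Field K] (ε : ℤˣ) : ((ε : ℤ) : K) ≠ 0 := by
  rcases Int.units_eq_one_or ε with rfl | rfl <;> simp

theorem units_cast_inv {K : Type*} [Field K] (ε : ℤˣ) : (((ε : ℤ) : K))⁻¹ = ((ε : ℤ) : K) := by
  rcases Int.units_eq_one_or ε with rfl | rfl <;> simp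

theorem units_cast_zpow {K : Type*} [Field K] (ε : ℤˣ) (n : ℤ) :
    (((ε ^ n : ℤˣ) : ℤ) : K) = ((ε : ℤ) : K) ^ n := by
  rcases Int.units_eq_one_or ε with rfl | rfl
  · simp
  · rcases Int.even_or_odd n with h | h
    · simp [h.neg_one_zpow]
    · simp [h.neg_one_zpow]

theorem constantCoeff_mon (ε : ℤˣ) {a : ℤ} (ha : 0 < a) : constantCoeff (mon ε a) = 0 := by
  simp [mon, show a.toNat ≠ 0 by lia]

theorem map_prod_one_add {r k : ℤ} (hr : 0 ≤ r) (hk : 0 ≤ k) (ε : ℤˣ) (N : ℕ) :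
    algebraMap ℤ⟦X⟧ (FractionRing ℤ⟦X⟧)
      (∏ i ∈ Finset.range N, (1 + mon ε k * mon 1 (2 * r) ^ i)) =
      ∏ i ∈ Finset.range N, (1 + ((ε : ℤ) : FractionRing ℤ⟦X⟧) *
        algebraMap ℤ⟦X⟧ (FractionRing ℤ⟦X⟧) X ^ k *
        ((algebraMap ℤ⟦X⟧ (FractionRing ℤ⟦X⟧) X ^ r) ^ 2) ^ i) := by
  have h : ∀ x : FractionRing ℤ⟦X⟧, x ^ (2 * r) = (x ^ r) ^ 2 := fun x => by
    rw [mul_comm, zpow_mul, zpow_ofNat]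
  simp [algebraMap_mon _ hk, algebraMap_mon _ (show 0 ≤ 2 * r by lia), h]

theorem map_prod_one_add' {r k : ℤ} (hr : 0 ≤ r) (hk : k ≤ 2 * r) (ε : ℤˣ) (N : ℕ) :
    algebraMap ℤ⟦X⟧ (FractionRing ℤ⟦X⟧)
      (∏ i ∈ Finset.range N, (1 + mon ε (2 * r - k) * mon 1 (2 * r) ^ i)) =
      ∏ i ∈ Finset.range N, (1 + (((ε : ℤ) : FractionRing ℤ⟦X⟧) *
        algebraMap ℤ⟦X⟧ (FractionRing ℤ⟦X⟧) X ^ k)⁻¹ *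
        ((algebraMap ℤ⟦X⟧ (FractionRing ℤ⟦X⟧) X ^ r) ^ 2) ^ (i + 1)) := by
  rw [map_prod_one_add hr (by lia)]
  refine Finset.prod_congr rfl fun i _ => ?_
  have hx := algebraMap_X_ne_zero
  rw [mul_inv, units_cast_inv, pow_succ, zpow_sub₀ hx, mul_comm 2, zpow_mul, zpow_ofNat,
    div_eq_mul_inv]
  ring

theorem finite_triple_product_mon {r k : ℤ} (hk : 0 ≤ k) (hkr : k ≤ 2 * r) (ε : ℤˣ)
    (N : ℕ) :
    (∏ i ∈ Finset.range N, (1 + mon ε k * mon 1 (2 * r) ^ i)) *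
        ∏ i ∈ Finset.range N, (1 + mon ε (2 * r - k) * mon 1 (2 * r) ^ i) =
      ∑ n ∈ Finset.Icc (-N : ℤ) N, gaussBinom (mon 1 (2 * r)) (2 * N) (n + N).toNat *
        mon (ε ^ n) (r * (n * (n - 1)) + k * n) := by
  have hr : 0 ≤ r := by lia
  have hx := algebraMap_X_ne_zero
  -- The finite identities involve negative powers of q, which exist only in the fraction field.
  refine IsFractionRing.injective ℤ⟦X⟧ (FractionRing ℤ⟦X⟧) ?_
  rw [map_mul, map_prod_one_add hr hk, map_prod_one_add' hr hkr,
    finite_triple_product (zpow_ne_zero _ hx) (mul_ne_zero (units_cast_ne_zero ε)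
      (zpow_ne_zero _ hx)), map_sum]
  rw [sum_range_eq_sum_Icc (fun i n => gaussBinom ((algebraMap ℤ⟦X⟧ (FractionRing ℤ⟦X⟧) X ^ r) ^ 2)
    (2 * N) i * ((algebraMap ℤ⟦X⟧ (FractionRing ℤ⟦X⟧) X ^ r) ^ (n * (n - 1)) *
      (((ε : ℤ) : FractionRing ℤ⟦X⟧) * algebraMap ℤ⟦X⟧ (FractionRing ℤ⟦X⟧) X ^ k) ^ n))]
  refine Finset.sum_congr rfl fun n _ => ?_
  have hm := algebraMap_mon 1 (show 0 ≤ 2 * r by lia)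
  simp only [Units.val_one, Int.cast_one, one_mul] at hm
  rw [map_mul, map_gaussBinom, hm, mul_comm 2 r, zpow_mul _ r 2, zpow_ofNat,
    algebraMap_mon _ (exponent_nonneg hk hkr n), units_cast_zpow, mul_zpow, zpow_add₀ hx,
    ← zpow_mul, ← zpow_mul]
  ring

theorem qPochInf_neg_mon_tendsto {r : ℤ} (h0 : 0 < r) (k : ℤ) (ε : ℤˣ) :
    Tendsto (fun N : ℕ => ∏ i ∈ Finset.range N, (1 + mon ε k * mon 1 (2 * r) ^ i)) atTop
      (𝓝 (qPochInf (-mon ε k) (mon 1 (2 * r)))) := by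
  have h := tendsto_prod_qPochInf (-mon ε k) (constantCoeff_mon 1 (show 0 < 2 * r by lia))
  simpa only [neg_mul, sub_neg_eq_add] using h

/-- Jacobi's triple product identity. -/
theorem triple_product {r k : ℤ} (h0 : 0 < r) (hk : 0 ≤ k) (hkr : k ≤ 2 * r) (ε : ℤˣ) :
    qPochInf (-mon ε k) (mon 1 (2 * r)) * qPochInf (-mon ε (2 * r - k)) (mon 1 (2 * r)) *
      qPochInf (mon 1 (2 * r)) (mon 1 (2 * r)) = T r k ε := by
  have hq := constantCoeff_mon 1 (show 0 < 2 * r by lia)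
  have h1 := ((qPochInf_neg_mon_tendsto h0 k ε).mul
    (qPochInf_neg_mon_tendsto h0 (2 * r - k) ε)).mul_const
      (qPochInf (mon 1 (2 * r)) (mon 1 (2 * r)))
  refine tendsto_nhds_unique h1 ?_
  have h2 := tendsto_sum_of_small (small_mon h0 hk hkr (ε ^ ·))
    (u := fun N n => qPochInf (mon 1 (2 * r)) (mon 1 (2 * r)) *
      gaussBinom (mon 1 (2 * r)) (2 * N) (n + N).toNat * mon (ε ^ n) (r * (n * (n - 1)) + k * n))
    (v := fun n => mon (ε ^ n) (r * (n * (n - 1)) + k * n)) (fun _ _ => Dvd.intro_left _ rfl)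
    (fun _ => dvd_rfl)
    (fun n => by simpa using (tendsto_gaussBinom hq n).mul_const _)
    (fun N => Finset.Icc (-N : ℤ) N)
    (fun n => eventually_atTop.mpr ⟨n.natAbs, fun N hN => by
      simp only [Finset.mem_Icc]
      lia⟩)
  refine h2.congr fun N => ?_
  rw [finite_triple_product_mon hk hkr, Finset.sum_mul]
  exact Finset.sum_congr rfl fun n _ => by ring

/-! ### Partial fraction expansion of the reciprocal of a theta series -/

/-- The expansion of `1 / (1 - δ q^d)` in powers of `q`. -/
noncomputable def recip (δ : ℤˣ) (d : ℤ) : ℤ⟦X⟧ :=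
  if 0 < d then Ring.inverse (1 - mon δ d) else -mon δ (-d) * Ring.inverse (1 - mon δ (-d))

theorem recip_one (d : ℤ) : recip 1 d = recipOneSub d := by
  simp [recip, recipOneSub, mon]

theorem isUnit_one_sub_mon (δ : ℤˣ) {d : ℤ} (hd : 0 < d) : IsUnit (1 - mon δ d) :=
  isUnit_of_constantCoeff_eq_one (by rw [map_sub, constantCoeff_mon δ hd]; simp)

theorem algebraMap_recip (δ : ℤˣ) {d : ℤ} (hd : d ≠ 0) :
    algebraMap ℤ⟦X⟧ (FractionRing ℤ⟦X⟧) (recip δ d) * (1 - ((δ : ℤ) : FractionRing ℤ⟦X⟧) *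
      algebraMap ℤ⟦X⟧ (FractionRing ℤ⟦X⟧) X ^ d) = 1 := by
  have hx := algebraMap_X_ne_zero
  unfold recip
  split_ifs with h
  · have := congrArg (algebraMap ℤ⟦X⟧ (FractionRing ℤ⟦X⟧))
      (Ring.inverse_mul_cancel _ (isUnit_one_sub_mon δ h))
    rwa [map_mul, map_sub, algebraMap_mon _ h.le, map_one] at this
  · have := congrArg (algebraMap ℤ⟦X⟧ (FractionRing ℤ⟦X⟧))
      (Ring.inverse_mul_cancel _ (isUnit_one_sub_mon δ (show 0 < -d by lia)))
    rw [map_mul, map_sub, algebraMap_mon _ (by lia), map_one] at this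
    rw [map_mul, map_neg, algebraMap_mon _ (by lia)]
    have h1 : algebraMap ℤ⟦X⟧ (FractionRing ℤ⟦X⟧) X ^ (-d) *
        algebraMap ℤ⟦X⟧ (FractionRing ℤ⟦X⟧) X ^ d = 1 := by
      rw [← zpow_add₀ hx, neg_add_cancel, zpow_zero]
    have h2 : ((δ : ℤ) : FractionRing ℤ⟦X⟧) * ((δ : ℤ) : FractionRing ℤ⟦X⟧) = 1 := by
      rcases Int.units_eq_one_or δ with rfl | rfl <;> simp
    linear_combination this + ((δ : ℤ) : FractionRing ℤ⟦X⟧) ^ 2 *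
      algebraMap ℤ⟦X⟧ (FractionRing ℤ⟦X⟧) (Ring.inverse (1 - mon δ (-d))) * h1 +
      algebraMap ℤ⟦X⟧ (FractionRing ℤ⟦X⟧) (Ring.inverse (1 - mon δ (-d))) * h2

/-- With x = η q^a and y = δ q^d this is xy/(1 - y) = x/(1 - y) - x. It drives all the functional
equations below. -/
theorem mon_mul_recip (δ η : ℤˣ) {a d : ℤ} (hd : d ≠ 0) (ha : 0 ≤ a) (had : 0 ≤ a + d) :
    mon (η * δ) (a + d) * recip δ d = mon η a * recip δ d - mon η a := by
  refine IsFractionRing.injective ℤ⟦X⟧ (FractionRing ℤ⟦X⟧) ?_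
  have h := algebraMap_recip δ hd
  rw [map_mul, map_sub, map_mul, algebraMap_mon _ ha, algebraMap_mon _ had,
    zpow_add₀ algebraMap_X_ne_zero]
  push_cast
  linear_combination (-((η : ℤ) : FractionRing ℤ⟦X⟧) *
    algebraMap ℤ⟦X⟧ (FractionRing ℤ⟦X⟧) X ^ a) * h

theorem finite_partial_fractions_mon {r k : ℤ} (hk : 0 < k) (hkr : k < 2 * r) (δ : ℤˣ)
    (N : ℕ) :
    (∏ i ∈ Finset.range N, (1 + mon (-δ) k * mon 1 (2 * r) ^ i)) *
        (∏ i ∈ Finset.range N, (1 + mon (-δ) (2 * r - k) * mon 1 (2 * r) ^ i)) *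
        (1 - mon δ k * mon 1 (2 * r) ^ N) *
      ∑ n ∈ Finset.Icc (-N : ℤ) N, gaussBinom (mon 1 (2 * r)) (2 * N) (n + N).toNat *
        (mon ((-1) ^ n) (r * (n * (n - 1)) + 2 * r * n) * recip δ (2 * r * n + k)) =
      qFactorial (mon 1 (2 * r)) (2 * N) := by
  have hr : 0 ≤ r := by lia
  have hx := algebraMap_X_ne_zero
  refine IsFractionRing.injective ℤ⟦X⟧ (FractionRing ℤ⟦X⟧) ?_
  set x := algebraMap ℤ⟦X⟧ (FractionRing ℤ⟦X⟧) X with hxd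
  set e : FractionRing ℤ⟦X⟧ := ((δ : ℤ) : FractionRing ℤ⟦X⟧) with he
  have hd : ∀ n : ℤ, 2 * r * n + k ≠ 0 := by
    intro n hn
    rcases lt_trichotomy n 0 with h | rfl | h <;> nlinarith
  have e1 : ∀ n : ℤ, 1 - e * x ^ k * (x ^ r) ^ (2 * n) = 1 - e * x ^ (2 * r * n + k) := by
    intro n
    rw [← zpow_mul, zpow_add₀ hx]
    ring_nf
  have h1 : ∀ n : ℤ, 1 - e * x ^ k * (x ^ r) ^ (2 * n) ≠ 0 := fun n => by
    rw [e1]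
    exact right_ne_zero_of_mul_eq_one (algebraMap_recip δ (hd n))
  have h := finite_partial_fractions (zpow_ne_zero r hx)
    (mul_ne_zero (units_cast_ne_zero δ) (zpow_ne_zero k hx)) h1 N
  have hq : x ^ (2 * r) = (x ^ r) ^ 2 := by rw [mul_comm, zpow_mul, zpow_ofNat]
  have hm := algebraMap_mon 1 (show 0 ≤ 2 * r by lia)
  simp only [Units.val_one, Int.cast_one, one_mul] at hm
  rw [← hxd, hq] at hm
  have hneg : (((-δ : ℤˣ) : ℤ) : FractionRing ℤ⟦X⟧) = -e := by simp [he]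
  rw [map_mul, map_mul, map_mul, map_prod_one_add hr hk.le, map_prod_one_add' hr hkr.le, map_sub,
    map_mul, map_pow, algebraMap_mon _ hk.le, map_one, map_qFactorial, hm, ← h, map_sum, hneg,
    neg_mul]
  congr 1
  rw [sum_range_eq_sum_Icc (fun i n => gaussBinom ((x ^ r) ^ 2) (2 * N) i *
    ((-1) ^ n * (x ^ r) ^ (n * (n + 1)) * (1 - e * x ^ k * (x ^ r) ^ (2 * n))⁻¹))]
  refine Finset.sum_congr rfl fun n _ => ?_
  rw [map_mul, map_mul, map_gaussBinom, hm,
    algebraMap_mon _ (exponent_nonneg (by lia) (by lia) n), units_cast_zpow, e1,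
    eq_inv_of_mul_eq_one_left (algebraMap_recip δ (hd n)), ← zpow_mul]
  have e2 : r * (n * (n - 1)) + 2 * r * n = r * (n * (n + 1)) := by ring
  rw [e2]
  simp [he, hxd]

/-- The limit N → ∞ of the finite partial fractions: 1/theta as a sum over its poles. -/
theorem T_mul_tsum_recip {r k : ℤ} (hk : 0 < k) (hkr : k < 2 * r) (δ : ℤˣ) :
    T r k (-δ) * ∑' n : ℤ, mon ((-1) ^ n) (r * (n * (n - 1)) + 2 * r * n) *
      recip δ (2 * r * n + k) = qPochInf (mon 1 (2 * r)) (mon 1 (2 * r)) ^ 3 := by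
  have h0 : 0 < r := by lia
  have hq := constantCoeff_mon 1 (show 0 < 2 * r by lia)
  have hs := small_mon h0 (show 0 ≤ 2 * r by lia) le_rfl ((-1) ^ ·)
  have h2 := tendsto_sum_of_small hs
    (u := fun N n => qPochInf (mon 1 (2 * r)) (mon 1 (2 * r)) *
      gaussBinom (mon 1 (2 * r)) (2 * N) (n + N).toNat *
      (mon ((-1) ^ n) (r * (n * (n - 1)) + 2 * r * n) * recip δ (2 * r * n + k)))
    (v := fun n => mon ((-1) ^ n) (r * (n * (n - 1)) + 2 * r * n) * recip δ (2 * r * n + k))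
    (fun _ _ => (dvd_mul_right _ _).mul_left _)
    (fun _ => dvd_mul_right _ _)
    (fun n => by simpa using (tendsto_gaussBinom hq n).mul_const _)
    (fun N => Finset.Icc (-N : ℤ) N)
    (fun n => eventually_atTop.mpr ⟨n.natAbs, fun N hN => by
      simp only [Finset.mem_Icc]
      lia⟩)
  -- The factor for the unpaired pole disappears in the limit.
  have h3 : Tendsto (fun N : ℕ => 1 - mon δ k * mon 1 (2 * r) ^ N) atTop (𝓝 1) := by
    rw [tendsto_iff_X_pow_dvd]
    refine fun d => eventually_atTop.mpr ⟨d, fun N hN => ?_⟩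
    rw [sub_sub_cancel_left, dvd_neg]
    exact ((pow_dvd_pow X hN).trans (pow_dvd_pow_of_dvd (X_dvd_iff.mpr hq) N)).mul_left _
  have h4 := (((qPochInf_neg_mon_tendsto h0 k (-δ)).mul
    (qPochInf_neg_mon_tendsto h0 (2 * r - k) (-δ))).mul h3).mul h2
  have h5 : Tendsto (fun N : ℕ => qPochInf (mon 1 (2 * r)) (mon 1 (2 * r)) *
      qFactorial (mon 1 (2 * r)) (2 * N)) atTop (𝓝 (qPochInf (mon 1 (2 * r)) (mon 1 (2 * r)) *
        qPochInf (mon 1 (2 * r)) (mon 1 (2 * r)))) :=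
    ((tendsto_qFactorial hq).comp
      (tendsto_atTop.mpr fun b => eventually_atTop.mpr ⟨b, fun N hN => by lia⟩)).const_mul _
  have h6 := tendsto_nhds_unique h4 (h5.congr fun N => by
    rw [← finite_partial_fractions_mon hk hkr δ N, Finset.mul_sum, Finset.mul_sum, Finset.mul_sum]
    exact Finset.sum_congr rfl fun n _ => by ring)
  rw [← triple_product h0 hk.le hkr.le]
  linear_combination qPochInf (mon 1 (2 * r)) (mon 1 (2 * r)) * h6

end AppellLerch

namespace AppellLerch

open PowerSeries Filter Topology
open scoped PowerSeries.WithPiTopology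

/-! ### Differences of Appell-Lerch sums -/

theorem mul_succ_nonneg (n : ℤ) : 0 ≤ n * (n + 1) := by
  have := mul_pred_nonneg (n + 1)
  rwa [add_sub_cancel_right, mul_comm] at this

section Appell

variable {r k : ℤ}

theorem linear_ne_zero (hk : 0 < k) (hkr : k < 2 * r) (n : ℤ) : 2 * r * n + k ≠ 0 := by
  intro hn
  rcases lt_trichotomy n 0 with h | rfl | h <;> nlinarith

/-- `∑ (-δ)ⁿ q^{r n (n - 1) + k n} / (1 - δ q^{2 r (n + m) + k})`. -/
noncomputable def appellSum (r k : ℤ) (δ : ℤˣ) (m : ℤ) : ℤ⟦X⟧ :=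
  ∑' n : ℤ, mon ((-δ) ^ n) (r * (n * (n - 1)) + k * n) * recip δ (2 * r * (n + m) + k)

theorem small_appellSum (hk : 0 < k) (hkr : k < 2 * r) (δ : ℤˣ) (m : ℤ) :
    Small fun n : ℤ => mon ((-δ) ^ n) (r * (n * (n - 1)) + k * n) *
      recip δ (2 * r * (n + m) + k) :=
  (small_mon (by lia) hk.le hkr.le ((-δ) ^ ·)).of_dvd fun _ => dvd_mul_right _ _

/-- After n ↦ n + 1 the denominators agree, and the numerators differ by the factor -δ
q^{2r(n+m)+k}; `mon_mul_recip` then splits off the theta series. The same relation for m ≤ 0 is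
stated separately, with the power of q on the other side, to keep exponents nonnegative. -/
theorem appellSum_up (hk : 0 < k) (hkr : k < 2 * r) (δ : ℤˣ) {m : ℤ} (hm : 0 ≤ m) :
    mon 1 (2 * r * m) * appellSum r k δ (m - 1) = T r k (-δ) - appellSum r k δ m := by
  have h0 : 0 < r := by lia
  have hrm : 0 ≤ 2 * r * m := by positivity
  unfold appellSum T
  rw [(small_appellSum hk hkr δ (m - 1)).const_mul_tsum, ← (Equiv.addRight (1 : ℤ)).tsum_eq,
    ← (small_mon h0 hk.le hkr.le ((-δ) ^ ·)).summable.tsum_sub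
      (small_appellSum hk hkr δ m).summable]
  refine tsum_congr fun n => ?_
  have e1 := exponent_nonneg hk.le hkr.le (r := r) n
  have e2 := exponent_nonneg hk.le hkr.le (r := r) (n + 1)
  have h := mon_mul_recip δ ((-δ) ^ n) (linear_ne_zero hk hkr (n + m)) e1 (by
    calc (0 : ℤ) ≤ 2 * r * m + (r * ((n + 1) * (n + 1 - 1)) + k * (n + 1)) := add_nonneg hrm e2
      _ = _ := by ring)
  simp only [Equiv.coe_addRight]
  rw [← mul_assoc, mon_mul_mon _ _ hrm e2, zpow_add_one, one_mul, mul_neg, mon_neg,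
    show n + 1 + (m - 1) = n + m by ring]
  rw [show 2 * r * m + (r * ((n + 1) * (n + 1 - 1)) + k * (n + 1)) =
    r * (n * (n - 1)) + k * n + (2 * r * (n + m) + k) by ring]
  linear_combination -h

theorem appellSum_down (hk : 0 < k) (hkr : k < 2 * r) (δ : ℤˣ) {m : ℤ} (hm : m ≤ 0) :
    appellSum r k δ (m - 1) = mon 1 (-(2 * r * m)) * (T r k (-δ) - appellSum r k δ m) := by
  have h0 : 0 < r := by lia
  have hrm : 0 ≤ -(2 * r * m) := by nlinarith
  have hs := small_mon h0 hk.le hkr.le ((-δ) ^ ·)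
  unfold appellSum T
  rw [← hs.summable.tsum_sub (small_appellSum hk hkr δ m).summable,
    ← (hs.summable.sub (small_appellSum hk hkr δ m).summable).tsum_mul_left,
    ← (Equiv.addRight (1 : ℤ)).tsum_eq]
  refine tsum_congr fun n => ?_
  have e1 := exponent_nonneg hk.le hkr.le (r := r) n
  have e2 := exponent_nonneg hk.le hkr.le (r := r) (n + 1)
  have h := mon_mul_recip δ ((-δ) ^ n) (linear_ne_zero hk hkr (n + m)) (add_nonneg hrm e1) (by
    calc (0 : ℤ) ≤ r * ((n + 1) * (n + 1 - 1)) + k * (n + 1) := e2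
      _ = _ := by ring)
  simp only [Equiv.coe_addRight]
  rw [zpow_add_one, mul_neg, mon_neg, show n + 1 + (m - 1) = n + m by ring]
  rw [show r * ((n + 1) * (n + 1 - 1)) + k * (n + 1) =
    -(2 * r * m) + (r * (n * (n - 1)) + k * n) + (2 * r * (n + m) + k) by ring]
  have h2 := mon_mul_mon 1 ((-δ) ^ n) hrm e1
  rw [one_mul] at h2
  linear_combination -h + (recip δ (2 * r * (n + m) + k) - 1) * h2

/-- The combination of Appell-Lerch sums that transforms like a theta series. -/
noncomputable def appellDiff (r k : ℤ) (m : ℤ) : ℤ⟦X⟧ :=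
  T r k 1 * appellSum r k 1 m - T r k (-1) * appellSum r k (-1) m

/-- The inhomogeneous terms for δ = 1 and δ = -1 are both `T r k 1 * T r k (-1)` and cancel, leaving
D(m) = -q^{2rm} D(m - 1), which is iterated in both directions. -/
theorem appellDiff_eq (hk : 0 < k) (hkr : k < 2 * r) (n : ℤ) :
    appellDiff r k (n - 1) = mon ((-1) ^ n) (r * (n * (n - 1))) * appellDiff r k (-1) := by
  have h0 : 0 < r := by lia
  have hn : ∀ n : ℤ, 0 ≤ r * (n * (n - 1)) := fun n => mul_nonneg h0.le (mul_pred_nonneg n)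
  induction n with
  | zero => simp
  | succ n ih =>
    have h1 := appellSum_up hk hkr 1 (m := n) (by positivity)
    have h2 := appellSum_up hk hkr (-1) (m := n) (by positivity)
    have h3 : appellDiff r k n = -mon 1 (2 * r * n) * appellDiff r k (n - 1) := by
      unfold appellDiff
      rw [neg_neg] at h2
      linear_combination T r k 1 * h1 - T r k (-1) * h2
    rw [add_sub_cancel_right, h3, ih, ← mul_assoc, neg_mul,
      mon_mul_mon _ _ (by positivity) (hn n), ← mon_neg]
    congr 2
    · rw [zpow_add_one]
      simp
    · ring
  | pred n ih =>
    have h1 := appellSum_down hk hkr 1 (m := -n - 1) (by lia)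
    have h2 := appellSum_down hk hkr (-1) (m := -n - 1) (by lia)
    have h3 : appellDiff r k (-n - 1 - 1) =
        -mon 1 (-(2 * r * (-n - 1))) * appellDiff r k (-n - 1) := by
      unfold appellDiff
      rw [neg_neg] at h2
      linear_combination T r k 1 * h1 - T r k (-1) * h2
    rw [h3, ih, ← mul_assoc, neg_mul, mon_mul_mon _ _ (by nlinarith) (hn (-n)), ← mon_neg]
    congr 2
    · rw [zpow_sub_one]
      simp
    · ring

/-- `∑ (-1)ⁱ q^{r (i - m) (i - m + 1)} / (1 - δ q^{2 r i + k})`. -/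
noncomputable def recipSum (r k : ℤ) (δ : ℤˣ) (m : ℤ) : ℤ⟦X⟧ :=
  ∑' i : ℤ, mon ((-1) ^ i) (r * ((i - m) * (i - m + 1))) * recip δ (2 * r * i + k)

theorem small_recipSum_mon (h0 : 0 < r) (m : ℤ) :
    Small fun i : ℤ => mon ((-1) ^ i) (r * ((i - m) * (i - m + 1))) := by
  have h := (small_mon h0 (show 0 ≤ 2 * r by lia) le_rfl fun i => (-1) ^ (i + m)).comp_injective
    (sub_left_injective (b := m))
  refine h.of_dvd fun i => ?_
  rw [sub_add_cancel, show r * ((i - m) * (i - m - 1)) + 2 * r * (i - m) =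
    r * ((i - m) * (i - m + 1)) by ring]

theorem small_recipSum (h0 : 0 < r) (δ : ℤˣ) (m : ℤ) :
    Small fun i : ℤ => mon ((-1) ^ i) (r * ((i - m) * (i - m + 1))) * recip δ (2 * r * i + k) :=
  (small_recipSum_mon h0 m).of_dvd fun _ => dvd_mul_right _ _

/-- A translate of `T_zero_neg_one`. This vanishing is why the functional equation of `recipSum` has
no inhomogeneous term. -/
theorem tsum_mon_recipSum (r m : ℤ) :
    ∑' i : ℤ, mon ((-1) ^ i) (r * ((i - m) * (i - m + 1))) = 0 := by
  have h := T_zero_neg_one r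
  unfold T at h
  rw [← (Equiv.addRight (m - 1)).tsum_eq]
  rcases Int.even_or_odd (m - 1) with hm | hm
  · rw [← h]
    refine tsum_congr fun n => ?_
    rw [Equiv.coe_addRight, zpow_add, hm.neg_one_zpow, mul_one]
    congr 1
    ring
  · rw [← neg_zero, ← h, ← tsum_neg]
    refine tsum_congr fun n => ?_
    rw [Equiv.coe_addRight, zpow_add, hm.neg_one_zpow, mul_neg_one, mon_neg]
    congr 2
    ring

/-- Multiplying by δ q^{2rm+k} and moving the centre from m to m + 1 changes each term by its
numerator alone, and the numerators sum to zero. -/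
theorem recipSum_up (hk : 0 < k) (hkr : k < 2 * r) (δ : ℤˣ) {m : ℤ} (hm : 0 ≤ m) :
    recipSum r k δ (m + 1) = mon δ (2 * r * m + k) * recipSum r k δ m := by
  have h0 : 0 < r := by lia
  have hrm : 0 ≤ 2 * r * m + k := by positivity
  unfold recipSum
  rw [(small_recipSum h0 δ m).const_mul_tsum, ← sub_zero (∑' _, _), ← tsum_mon_recipSum r (m + 1),
    ← (small_recipSum h0 δ (m + 1)).summable.tsum_sub (small_recipSum_mon h0 (m + 1)).summable]
  refine tsum_congr fun i => ?_
  have e1 : ∀ m : ℤ, 0 ≤ r * ((i - m) * (i - m + 1)) := fun m =>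
    mul_nonneg h0.le (mul_succ_nonneg _)
  rw [← mul_assoc (mon δ _), mon_mul_mon _ _ hrm (e1 m), mul_comm δ, ← mon_mul_recip δ ((-1) ^ i)
    (linear_ne_zero hk hkr i) (e1 (m + 1)) (by
      calc (0 : ℤ) ≤ 2 * r * m + k + r * ((i - m) * (i - m + 1)) := add_nonneg hrm (e1 m)
        _ = _ := by ring)]
  congr 2
  ring

theorem recipSum_down (hk : 0 < k) (hkr : k < 2 * r) (δ : ℤˣ) {m : ℤ} (hm : m < 0) :
    recipSum r k δ m = mon δ (-(2 * r * m + k)) * recipSum r k δ (m + 1) := by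
  have h0 : 0 < r := by lia
  have hrm : 0 ≤ -(2 * r * m + k) := by nlinarith
  unfold recipSum
  rw [← sub_zero (∑' i : ℤ, mon ((-1) ^ i) (r * ((i - (m + 1)) * (i - (m + 1) + 1))) * _),
    ← tsum_mon_recipSum r (m + 1),
    ← (small_recipSum h0 δ (m + 1)).summable.tsum_sub (small_recipSum_mon h0 (m + 1)).summable,
    ← ((small_recipSum h0 δ (m + 1)).summable.sub
      (small_recipSum_mon h0 (m + 1)).summable).tsum_mul_left]
  refine tsum_congr fun i => ?_
  have e1 : ∀ m : ℤ, 0 ≤ r * ((i - m) * (i - m + 1)) := fun m =>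
    mul_nonneg h0.le (mul_succ_nonneg _)
  have e2 : r * ((i - m) * (i - m + 1)) = -(2 * r * m + k) +
      r * ((i - (m + 1)) * (i - (m + 1) + 1)) + (2 * r * i + k) := by ring
  have h := mon_mul_recip δ (δ * (-1) ^ i) (linear_ne_zero hk hkr i)
    (add_nonneg hrm (e1 (m + 1))) (e2 ▸ e1 m)
  rw [← e2, mul_right_comm, Int.units_mul_self, one_mul] at h
  rw [h, ← mon_mul_mon _ _ hrm (e1 (m + 1))]
  ring

theorem recipSum_eq (hk : 0 < k) (hkr : k < 2 * r) (δ : ℤˣ) (m : ℤ) :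
    recipSum r k δ m = mon (δ ^ m) (r * (m * (m - 1)) + k * m) * recipSum r k δ 0 := by
  have h0 : 0 < r := by lia
  have e := exponent_nonneg hk.le hkr.le (r := r)
  induction m with
  | zero => simp
  | succ m ih =>
    rw [recipSum_up hk hkr δ (by positivity), ih, ← mul_assoc,
      mon_mul_mon _ _ (by positivity) (e m)]
    congr 2
    · rw [zpow_add_one, mul_comm]
    · ring
  | pred m ih =>
    have hrm : 0 ≤ -(2 * r * (-m - 1) + k) := by nlinarith
    rw [recipSum_down hk hkr δ (by lia), sub_add_cancel, ih, ← mul_assoc,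
      mon_mul_mon _ _ hrm (e (-m))]
    congr 2
    · rw [zpow_sub_one, Int.units_inv_eq_self, mul_comm]
    · ring

theorem T_mul_recipSum (hk : 0 < k) (hkr : k < 2 * r) (δ : ℤˣ) :
    T r k (-δ) * recipSum r k δ 0 = qPochInf (mon 1 (2 * r)) (mon 1 (2 * r)) ^ 3 := by
  rw [← T_mul_tsum_recip hk hkr δ]
  congr 1
  refine tsum_congr fun n => ?_
  congr 2
  ring

/-- Pairs of integers, sheared. -/
def shearEquiv : ℤ × ℤ ≃ ℤ × ℤ where
  toFun x := (x.2 - x.1 + 1, x.1)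
  invFun y := (y.2, y.1 + y.2 - 1)
  left_inv x := Prod.ext rfl (by ring)
  right_inv x := Prod.ext (by ring) rfl

/-- In the sheared double sum the denominator depends on i only. For fixed p the sum over i is
`recipSum` centred at p, that is δ^p q^{rp(p-1)+kp} times the one centred at 0. The two equal
factors in p multiply to the terms of `T (2 * r) (2 * k) 1`, free of δ. -/
theorem tsum_mon_mul_appellSum (hk : 0 < k) (hkr : k < 2 * r) (δ : ℤˣ) :
    ∑' n : ℤ, mon ((-1) ^ n) (r * (n * (n - 1))) * appellSum r k δ (n - 1) =
      -(T (2 * r) (2 * k) 1 * recipSum r k δ 0) := by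
  have h0 : 0 < r := by lia
  have hn : ∀ n : ℤ, 0 ≤ r * (n * (n - 1)) := fun n => mul_nonneg h0.le (mul_pred_nonneg n)
  have e := exponent_nonneg hk.le hkr.le (r := r)
  have hs0 : Small fun n : ℤ => mon ((-1) ^ n) (r * (n * (n - 1))) := by
    simpa using small_mon h0 le_rfl (show 0 ≤ 2 * r by lia) ((-1 : ℤˣ) ^ ·)
  have hs : Small fun x : ℤ × ℤ => mon ((-1) ^ x.1) (r * (x.1 * (x.1 - 1))) *
      (mon ((-δ) ^ x.2) (r * (x.2 * (x.2 - 1)) + k * x.2) *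
        recip δ (2 * r * (x.2 + (x.1 - 1)) + k)) :=
    (hs0.prod (small_mon h0 hk.le hkr.le ((-δ) ^ ·))).of_dvd fun x =>
      mul_dvd_mul_left _ (dvd_mul_right _ _)
  have h1 : ∑' n : ℤ, mon ((-1) ^ n) (r * (n * (n - 1))) * appellSum r k δ (n - 1) =
      ∑' x : ℤ × ℤ, mon ((-1) ^ x.1) (r * (x.1 * (x.1 - 1))) *
      (mon ((-δ) ^ x.2) (r * (x.2 * (x.2 - 1)) + k * x.2) *
        recip δ (2 * r * (x.2 + (x.1 - 1)) + k)) := by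
    rw [hs.tsum_prod]
    exact tsum_congr fun n => (small_appellSum hk hkr δ (n - 1)).const_mul_tsum _
  rw [h1, ← shearEquiv.tsum_eq, (hs.comp_injective shearEquiv.injective).tsum_prod]
  have h2 : ∀ p : ℤ, ∑' i : ℤ, mon ((-1) ^ (shearEquiv (p, i)).1)
      (r * ((shearEquiv (p, i)).1 * ((shearEquiv (p, i)).1 - 1))) *
      (mon ((-δ) ^ (shearEquiv (p, i)).2) (r * ((shearEquiv (p, i)).2 *
        ((shearEquiv (p, i)).2 - 1)) + k * (shearEquiv (p, i)).2) *
        recip δ (2 * r * ((shearEquiv (p, i)).2 + ((shearEquiv (p, i)).1 - 1)) + k)) =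
      -(mon (1 ^ p) (2 * r * (p * (p - 1)) + 2 * k * p) * recipSum r k δ 0) := by
    intro p
    have h3 : mon (1 ^ p) (2 * r * (p * (p - 1)) + 2 * k * p) =
        mon (δ ^ p) (r * (p * (p - 1)) + k * p) * mon (δ ^ p) (r * (p * (p - 1)) + k * p) := by
      rw [mon_mul_mon _ _ (e p) (e p), Int.units_mul_self, one_zpow]
      congr 1
      ring
    rw [h3, mul_assoc, ← recipSum_eq hk hkr δ p]
    unfold recipSum
    rw [(small_recipSum h0 δ p).const_mul_tsum, ← tsum_neg]
    refine tsum_congr fun i => ?_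
    simp only [shearEquiv, Equiv.coe_fn_mk, add_sub_cancel_right, add_sub_cancel]
    have e4 : r * ((i - p + 1) * (i - p)) = r * ((i - p) * (i - p + 1)) := by ring
    have e5 : (0 : ℤ) ≤ r * ((i - p) * (i - p + 1)) := mul_nonneg h0.le (mul_succ_nonneg _)
    have e6 : (-1 : ℤˣ) ^ (i - p + 1) * (-δ) ^ p = -(δ ^ p * (-1) ^ i) := by
      rw [zpow_add_one, zpow_sub, neg_eq_neg_one_mul δ, mul_zpow]
      simp only [mul_neg, mul_one, neg_mul, neg_inj]
      rw [mul_comm (δ ^ p), ← mul_assoc, inv_mul_cancel_right]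
    rw [e4, ← mul_assoc (mon _ _), ← mul_assoc (mon (δ ^ p) _), mon_mul_mon _ _ e5 (e p),
      mon_mul_mon _ _ (e p) e5, e6, mon_neg, neg_mul, add_comm (r * ((i - p) * (i - p + 1)))]
  rw [tsum_congr h2, tsum_neg]
  unfold T
  rw [((small_mon (by lia) (by lia) (by lia) (1 ^ ·)).summable.tsum_mul_right _)]

theorem constantCoeff_T (hk : 0 < k) (hkr : k < 2 * r) (ε : ℤˣ) : constantCoeff (T r k ε) = 1 := by
  have hq := constantCoeff_mon 1 (show 0 < 2 * r by lia)
  rw [← triple_product (by lia) hk.le hkr.le, map_mul, map_mul, constantCoeff_qPochInf _ hq,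
    constantCoeff_qPochInf _ hq, constantCoeff_qPochInf hq hq]
  · simp
  · rw [map_neg, constantCoeff_mon ε (by lia), neg_zero]
  · rw [map_neg, constantCoeff_mon ε hk, neg_zero]

theorem T_ne_zero (hk : 0 < k) (hkr : k < 2 * r) (ε : ℤˣ) : T r k ε ≠ 0 := fun h => by
  simpa [h] using constantCoeff_T hk hkr ε

theorem T_zero_one_ne_zero (h0 : 0 < r) : T (2 * r) 0 1 ≠ 0 := by
  rw [T_zero_one (by lia)]
  intro h
  have h1 := congrArg constantCoeff h
  rw [map_mul, constantCoeff_T (by lia) (by lia)] at h1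
  rw [mul_one, map_ofNat, map_zero] at h1
  exact two_ne_zero h1

/-- Weighting `appellDiff_eq` by the same Gaussian produces `T (2 * r) 0 1` on one side, and
`tsum_mon_mul_appellSum` evaluates the other. By `T_mul_recipSum` what remains is the difference of
the squares of `T r k 1` and `T r k (-1)`, in which `T_mul_T` exhibits the factor `T (2 * r) 0 1`,
cancelled at the end. -/
theorem appellDiff_formula (hk : 0 < k) (hkr : k ≤ r) :
    T r k 1 * T r k (-1) * appellDiff r k (-1) =
      -(2 * mon 1 k * qPochInf (mon 1 (2 * r)) (mon 1 (2 * r)) ^ 3 *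
        (T (2 * r) (2 * k) 1 * T (2 * r) (2 * k + 2 * r) 1)) := by
  have h0 : 0 < r := by lia
  have hkr' : k < 2 * r := by lia
  have hs0 : Small fun n : ℤ => mon ((-1) ^ n) (r * (n * (n - 1))) := by
    simpa using small_mon h0 le_rfl (show 0 ≤ 2 * r by lia) ((-1 : ℤˣ) ^ ·)
  have hsum : T (2 * r) 0 1 * appellDiff r k (-1) =
      -(T (2 * r) (2 * k) 1 * (T r k 1 * recipSum r k 1 0 - T r k (-1) * recipSum r k (-1) 0)) := by
    have h1 : ∑' n : ℤ, mon ((-1) ^ n) (r * (n * (n - 1))) * appellDiff r k (n - 1) =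
        T (2 * r) 0 1 * appellDiff r k (-1) := by
      unfold T
      rw [← (small_mon (by lia) le_rfl (by lia) (1 ^ ·)).summable.tsum_mul_right]
      refine tsum_congr fun n => ?_
      rw [appellDiff_eq hk hkr', ← mul_assoc, mon_mul_mon _ _
        (mul_nonneg h0.le (mul_pred_nonneg n)) (mul_nonneg h0.le (mul_pred_nonneg n)),
        Int.units_mul_self, one_zpow]
      congr 2
      ring
    have h2 := tsum_mon_mul_appellSum hk hkr' 1
    have h3 := tsum_mon_mul_appellSum hk hkr' (-1)
    have hs : ∀ δ, Small fun n : ℤ => mon ((-1) ^ n) (r * (n * (n - 1))) *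
        appellSum r k δ (n - 1) := fun δ => hs0.of_dvd fun _ => dvd_mul_right _ _
    rw [← h1]
    have h4 : ∀ n : ℤ, mon ((-1) ^ n) (r * (n * (n - 1))) * appellDiff r k (n - 1) =
        T r k 1 * (mon ((-1) ^ n) (r * (n * (n - 1))) * appellSum r k 1 (n - 1)) -
        T r k (-1) * (mon ((-1) ^ n) (r * (n * (n - 1))) * appellSum r k (-1) (n - 1)) := by
      intro n
      unfold appellDiff
      ring
    rw [tsum_congr h4, ((hs 1).mul_left _).summable.tsum_sub ((hs (-1)).mul_left _).summable,
      ← (hs 1).const_mul_tsum, ← (hs (-1)).const_mul_tsum, h2, h3]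
    ring
  have r1 := T_mul_recipSum hk hkr' 1
  have r2 := T_mul_recipSum hk hkr' (-1)
  have s1 := T_mul_T h0 hk.le le_rfl (by lia) 1 1
  have s2 := T_mul_T h0 hk.le le_rfl (by lia) (-1) (-1)
  rw [neg_neg] at r2
  rw [mon_neg, Int.units_mul_self, sub_self, ← two_mul k] at s2
  rw [mul_one, sub_self, ← two_mul k] at s1
  refine mul_left_cancel₀ (T_zero_one_ne_zero h0) ?_
  linear_combination T r k 1 * T r k (-1) * hsum - T (2 * r) (2 * k) 1 * T r k 1 ^ 2 * r1 +
    T (2 * r) (2 * k) 1 * T r k (-1) ^ 2 * r2 -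
    T (2 * r) (2 * k) 1 * qPochInf (mon 1 (2 * r)) (mon 1 (2 * r)) ^ 3 * (s1 - s2)

end Appell

end AppellLerch

namespace AppellLerch

open PowerSeries Filter Topology
open scoped PowerSeries.WithPiTopology

/-! ### Substitutions -/

section Substitution

variable {φ : ℤ⟦X⟧ →+* ℤ⟦X⟧}

theorem continuous_of_X_dvd (hφ : X ∣ φ X) : Continuous φ := by
  refine continuous_iff_continuousAt.mpr fun f => tendsto_iff_X_pow_dvd.mpr fun d => ?_
  have h : Tendsto (fun u : ℤ⟦X⟧ => u) (𝓝 f) (𝓝 f) := tendsto_id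
  filter_upwards [tendsto_iff_X_pow_dvd.mp h d] with u hu
  rw [← map_sub]
  refine (pow_dvd_pow_of_dvd hφ d).trans ?_
  rw [← map_pow]
  exact map_dvd φ hu

theorem map_qPochInf (hφ : X ∣ φ X) (a : ℤ⟦X⟧) {u : ℤ⟦X⟧} (hu : constantCoeff u = 0) :
    φ (qPochInf a u) = qPochInf (φ a) (φ u) := by
  unfold qPochInf
  rw [(multipliable_qPochInf a hu).map_tprod φ (continuous_of_X_dvd hφ)]
  simp

theorem map_ringInverse {u : ℤ⟦X⟧} (hu : IsUnit u) : φ (Ring.inverse u) = Ring.inverse (φ u) := by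
  obtain ⟨u, rfl⟩ := hu
  rw [Ring.inverse_unit]
  exact (Ring.inverse_unit (Units.map (φ : ℤ⟦X⟧ →* ℤ⟦X⟧) u)).symm

theorem map_mon_of_X_pow {m : ℕ} (hφ : φ X = X ^ m) (ε : ℤˣ) {a : ℤ} (ha : 0 ≤ a) :
    φ (mon ε a) = mon ε (m * a) := by
  obtain ⟨n, rfl⟩ := Int.eq_ofNat_of_zero_le ha
  rw [← Nat.cast_mul, mon_natCast, mon_natCast, map_mul, map_intCast, map_pow, hφ, pow_mul]

theorem map_T_of_X_pow {m : ℕ} (hm : m ≠ 0) (hφ : φ X = X ^ m) {r k : ℤ} (h0 : 0 < r)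
    (hk : 0 ≤ k) (hkr : k ≤ 2 * r) (ε : ℤˣ) : φ (T r k ε) = T (m * r) (m * k) ε := by
  unfold T
  rw [(small_mon h0 hk hkr (ε ^ ·)).summable.map_tsum φ
    (continuous_of_X_dvd (hφ ▸ dvd_pow_self X hm))]
  refine tsum_congr fun n => ?_
  rw [map_mon_of_X_pow hφ _ (exponent_nonneg hk hkr n)]
  congr 1
  ring

theorem map_E_of_X_pow {m : ℕ} (hm : m ≠ 0) (hφ : φ X = X ^ m) {j : ℕ} (hj : j ≠ 0) :
    φ (E j) = E (m * j) := by
  unfold E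
  rw [map_qPochInf (hφ ▸ dvd_pow_self X hm) _ (by simp [hj]), map_pow, hφ, pow_mul]

theorem map_mon_of_neg (hφ : φ X = -X) (ε : ℤˣ) {a : ℤ} (ha : 0 ≤ a) :
    φ (mon ε a) = mon (ε * (-1) ^ a) a := by
  obtain ⟨n, rfl⟩ := Int.eq_ofNat_of_zero_le ha
  rw [mon_natCast, mon_natCast, map_mul, map_intCast, map_pow, hφ, neg_pow,
    zpow_natCast]
  push_cast
  ring

/-- Since n(n - 1) is even and k is odd, the exponent has the parity of n, so q ↦ -q merely flips ε.
-/
theorem neg_one_zpow_exponent (r : ℤ) {k : ℤ} (hk : Odd k) (n : ℤ) :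
    (-1 : ℤˣ) ^ (r * (n * (n - 1)) + k * n) = (-1) ^ n := by
  obtain ⟨c, hc⟩ := Int.even_mul_pred_self n
  rw [zpow_add, hc, zpow_mul (-1) k n, hk.neg_one_zpow, ← two_mul, mul_left_comm,
    units_zpow_two_mul, one_mul]

theorem map_T_of_neg (hφ : φ X = -X) {r k : ℤ} (hko : Odd k) (h0 : 0 < r)
    (hk : 0 ≤ k) (hkr : k ≤ 2 * r) (ε : ℤˣ) : φ (T r k ε) = T r k (-ε) := by
  unfold T
  rw [(small_mon h0 hk hkr (ε ^ ·)).summable.map_tsum φ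
    (continuous_of_X_dvd (hφ ▸ (dvd_neg (α := ℤ⟦X⟧)).mpr dvd_rfl))]
  refine tsum_congr fun n => ?_
  rw [map_mon_of_neg hφ _ (exponent_nonneg hk hkr n), neg_one_zpow_exponent r hko, ← mul_zpow,
    mul_neg_one]

theorem map_recip_of_neg (hφ : φ X = -X) {d : ℤ} (hd : Odd d) (δ : ℤˣ) :
    φ (recip δ d) = recip (-δ) d := by
  unfold recip
  split_ifs with h
  · rw [map_ringInverse (isUnit_one_sub_mon δ h), map_sub, map_one, map_mon_of_neg hφ _ h.le,
      hd.neg_one_zpow, mul_neg_one]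
  · have hd0 : d ≠ 0 := by
      rintro rfl
      simp at hd
    rw [map_mul, map_ringInverse (isUnit_one_sub_mon δ (by lia)), map_sub, map_one, map_neg,
      map_mon_of_neg hφ _ (by lia), hd.neg.neg_one_zpow, mul_neg_one]

theorem map_appellSum_of_neg (hφ : φ X = -X) {r k : ℤ} (hko : Odd k) (hk : 0 < k)
    (hkr : k < 2 * r) (δ : ℤˣ) (m : ℤ) : φ (appellSum r k δ m) = appellSum r k (-δ) m := by
  unfold appellSum
  rw [(small_appellSum hk hkr δ m).summable.map_tsum φ
    (continuous_of_X_dvd (hφ ▸ (dvd_neg (α := ℤ⟦X⟧)).mpr dvd_rfl))]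
  refine tsum_congr fun n => ?_
  rw [map_mul, map_mon_of_neg hφ _ (exponent_nonneg hk.le hkr.le n), neg_one_zpow_exponent r hko,
    ← mul_zpow, mul_neg_one, map_recip_of_neg hφ]
  rw [mul_assoc]
  exact (even_two_mul _).add_odd hko

end Substitution

/-! ### The Appell-Lerch series -/

/-- The numerator exponent is 5(n+1)n + 3(n+1), so the sum is indexed by n + 1. This accounts for
the minus sign and for the shift m = -1. -/
theorem tsum_appellTerm : ∑' n : ℤ, appellTerm 3 10 n = -appellSum 5 3 1 (-1) := by
  unfold appellSum
  rw [← tsum_neg, ← (Equiv.addRight (1 : ℤ)).tsum_eq fun n : ℤ => -(mon ((-1) ^ n) _ * _)]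
  refine tsum_congr fun n => ?_
  rw [Equiv.coe_addRight, recip_one, zpow_add_one, mul_neg_one, mon_neg, neg_mul, neg_neg,
    appellTerm, mon]
  congr 2
  · rcases Int.even_or_odd n with h | h
    · rw [h.neg_one_zpow, (Int.natAbs_even.mpr h).neg_one_pow]
      simp
    · rw [h.neg_one_zpow, (Int.natAbs_odd.mpr h).neg_one_pow]
      simp
  · have := two_mul_tri n
    congr 2
    push_cast
    linear_combination 5 * this
  · push_cast
    ring

theorem T_five_neg_one {j : ℕ} (hj : j ≤ 10) :
    qPochInf (X ^ j) (X ^ 10) * qPochInf (X ^ (10 - j)) (X ^ 10) * qPochInf (X ^ 10) (X ^ 10) =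
      T 5 j (-1) := by
  rw [← triple_product (by norm_num) (by lia) (by lia)]
  simp only [mon_neg, neg_neg]
  rw [show (2 * 5 - j : ℤ) = ((10 - j : ℕ) : ℤ) by lia, show (2 * 5 : ℤ) = ((10 : ℕ) : ℤ) by rfl]
  simp only [mon_one_natCast]

theorem T_mul_appellSeries : T 5 3 (-1) * appellSeries 3 10 = -appellSum 5 3 1 (-1) := by
  have h := T_five_neg_one (j := 3) (by norm_num)
  norm_num at h
  rw [appellSeries, tsum_appellTerm]
  norm_num
  rw [h, Ring.mul_inverse_cancel_left]
  exact isUnit_of_constantCoeff_eq_one (constantCoeff_T (by norm_num) (by norm_num) _)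

theorem sub_evalNegHom (f : ℤ⟦X⟧) : f - evalNegHom f =
    2 * (X * expand 2 two_ne_zero (PowerSeries.mk fun n => coeff (2 * n + 1) f)) := by
  ext n
  rw [map_sub, evalNegHom, coeff_rescale, show (2 : ℤ⟦X⟧) = C 2 from rfl, coeff_C_mul]
  rcases n with _ | n
  · simp
  rw [coeff_succ_X_mul]
  rcases Nat.even_or_odd' n with ⟨c, rfl | rfl⟩
  · rw [coeff_expand_mul, coeff_mk, (odd_two_mul_add_one c).neg_one_pow]
    ring
  · rw [coeff_expand_of_not_dvd _ _ _ (by lia), Even.neg_one_pow ⟨c + 1, by ring⟩]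
    ring

theorem expand_injective {m : ℕ} (hm : m ≠ 0) :
    Function.Injective (expand m hm : ℤ⟦X⟧ →ₐ[ℤ] ℤ⟦X⟧) := by
  intro f g h
  ext n
  rw [← coeff_expand_mul m hm f, h, coeff_expand_mul]

theorem two_ne_zero_series : (2 : ℤ⟦X⟧) ≠ 0 := fun h => by
  have := congrArg constantCoeff h
  rw [map_ofNat, map_zero] at this
  exact two_ne_zero this

theorem expand_T {m : ℕ} (hm : m ≠ 0) {r k : ℤ} (h0 : 0 < r)
    (hk : 0 ≤ k) (hkr : k ≤ 2 * r) (ε : ℤˣ) : expand m hm (T r k ε) = T (m * r) (m * k) ε :=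
  map_T_of_X_pow (φ := (expand m hm : ℤ⟦X⟧ →ₐ[ℤ] ℤ⟦X⟧)) hm (expand_X m hm) h0 hk hkr ε

theorem expand_E {m : ℕ} (hm : m ≠ 0) {j : ℕ} (hj : j ≠ 0) : expand m hm (E j) = E (m * j) :=
  map_E_of_X_pow (φ := (expand m hm : ℤ⟦X⟧ →ₐ[ℤ] ℤ⟦X⟧)) hm (expand_X m hm) hj

/-- With T_± for `T 5 3` at ±1, the difference f(q) - f(-q) equals -D/(T_+ T_-), where D is
`appellDiff 5 3 (-1)`. Both T_+ T_- and the evaluation of D, up to a power of q, are series in q²,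
so comparison after q ↦ q² isolates the odd coefficients. -/
theorem odd_part_appellSeries :
    PowerSeries.mk (fun n : ℕ => a 3 10 (2 * n + 1)) * (T 5 3 (-1) * T 5 5 (-1)) ^ 2 =
      X * E 5 ^ 3 * (T 5 2 1 * T 5 3 1) := by
  refine expand_injective two_ne_zero ?_
  have h1 := T_mul_appellSeries
  have h2 := congrArg evalNegHom h1
  have h3 := appellDiff_formula (r := 5) (k := 3) (by norm_num) (by norm_num)
  have h4 := T_mul_T (r := 5) (k := 3) (l := 3) (by norm_num) (by norm_num) (by norm_num)
    (by norm_num) 1 (-1)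
  have h5 := sub_evalNegHom (appellSeries 3 10)
  rw [map_mul, map_neg, map_T_of_neg evalNegHom_X (by decide) (by norm_num) (by norm_num)
    (by norm_num), map_appellSum_of_neg evalNegHom_X (by decide) (by norm_num) (by norm_num)] at h2
  simp only [map_mul, map_pow, expand_X, expand_E two_ne_zero (show 5 ≠ 0 by norm_num)]
  rw [expand_T _ (by norm_num) (by norm_num) (by norm_num),
    expand_T _ (by norm_num) (by norm_num) (by norm_num),
    expand_T _ (by norm_num) (by norm_num) (by norm_num),
    expand_T _ (by norm_num) (by norm_num) (by norm_num)]
  have h6 := T_reflect 10 4 1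
  have h7 := T_zero_neg_one 10
  norm_num at h3 h4 h6 h7 ⊢
  rw [h7, mul_zero, add_zero] at h4
  rw [neg_neg] at h2
  have h8 : mon 1 10 = X ^ 10 := mon_one_natCast 10
  have h9 : mon 1 3 = X ^ 3 := mon_one_natCast 3
  rw [h6, h8, h9, show qPochInf (X ^ 10) (X ^ 10) = E 10 from rfl] at h3
  unfold appellDiff at h3
  refine mul_left_cancel₀ (mul_ne_zero two_ne_zero_series X_ne_zero) ?_
  simp only [a]
  rw [← h4]
  linear_combination (-(T 5 3 1 * T 5 3 (-1)) ^ 2) * h5 - h3 +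
    T 5 3 1 ^ 2 * T 5 3 (-1) * h1 - T 5 3 1 * T 5 3 (-1) ^ 2 * h2

end AppellLerch

namespace AppellLerch

open PowerSeries Filter Topology
open scoped PowerSeries.WithPiTopology

/-! ### Product formulas -/

theorem qPochInf_split (a : ℤ⟦X⟧) {u : ℤ⟦X⟧} (hu : constantCoeff u = 0) {m : ℕ} (hm : m ≠ 0) :
    qPochInf a u = ∏ j ∈ Finset.range m, qPochInf (a * u ^ j) (u ^ m) := by
  have h1 := (tendsto_prod_qPochInf a hu).comp
    (tendsto_id.const_mul_atTop' (Nat.pos_of_ne_zero hm))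
  have h2 : Tendsto (fun N => ∏ j ∈ Finset.range m, ∏ i ∈ Finset.range N,
      (1 - a * u ^ j * (u ^ m) ^ i)) atTop
      (𝓝 (∏ j ∈ Finset.range m, qPochInf (a * u ^ j) (u ^ m))) :=
    tendsto_finsetProd _ fun j _ => tendsto_prod_qPochInf _ (by simp [hu, hm])
  refine tendsto_nhds_unique h1 (h2.congr fun N => ?_)
  simp only [Function.comp_apply, id_eq]
  induction N with
  | zero => simp
  | succ N ih =>
    rw [mul_add_one, Finset.prod_range_add, ← ih, ← Finset.prod_mul_distrib]
    refine Finset.prod_congr rfl fun j _ => ?_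
    rw [Finset.prod_range_succ]
    ring

theorem qPochInf_neg_mul (a : ℤ⟦X⟧) {u : ℤ⟦X⟧} (hu : constantCoeff u = 0) :
    qPochInf (-a) u * qPochInf a u = qPochInf (a ^ 2) (u ^ 2) := by
  unfold qPochInf
  rw [← (multipliable_qPochInf (-a) hu).tprod_mul (multipliable_qPochInf a hu)]
  exact tprod_congr fun k => by ring

/-- `(q^i; q^n)_∞` -/
noncomputable def pochX (i n : ℕ) : ℤ⟦X⟧ := qPochInf (X ^ i) (X ^ n)

/-- `(-q^i; q^n)_∞` -/
noncomputable def pochNegX (i n : ℕ) : ℤ⟦X⟧ := qPochInf (-X ^ i) (X ^ n)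

theorem E_eq_pochX (j : ℕ) : E j = pochX j j := rfl

theorem pochX_split (i : ℕ) {n m : ℕ} (hn : n ≠ 0) (hm : m ≠ 0) :
    pochX i n = ∏ j ∈ Finset.range m, pochX (i + n * j) (n * m) := by
  unfold pochX
  rw [qPochInf_split _ (by simp [hn]) hm]
  exact Finset.prod_congr rfl fun j _ => by rw [pow_add, pow_mul, pow_mul]

theorem pochNegX_split (i : ℕ) {n m : ℕ} (hn : n ≠ 0) (hm : m ≠ 0) :
    pochNegX i n = ∏ j ∈ Finset.range m, pochNegX (i + n * j) (n * m) := by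
  unfold pochNegX
  rw [qPochInf_split _ (by simp [hn]) hm]
  exact Finset.prod_congr rfl fun j _ => by rw [pow_add, pow_mul, pow_mul, neg_mul]

theorem pochNegX_mul_pochX (i : ℕ) {n : ℕ} (hn : n ≠ 0) :
    pochNegX i n * pochX i n = pochX (2 * i) (2 * n) := by
  unfold pochX pochNegX
  rw [qPochInf_neg_mul _ (by simp [hn]), ← pow_mul, ← pow_mul, mul_comm i, mul_comm n]

theorem T_neg_one_eq {r k : ℕ} (h0 : 0 < r) (hk : k ≤ 2 * r) :
    T r k (-1) = pochX k (2 * r) * pochX (2 * r - k) (2 * r) * E (2 * r) := by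
  rw [← triple_product (by lia) (by lia) (by lia)]
  simp only [mon_neg, neg_neg]
  rw [show (2 * r - k : ℤ) = ((2 * r - k : ℕ) : ℤ) by lia,
    show (2 * r : ℤ) = ((2 * r : ℕ) : ℤ) by lia]
  simp only [mon_one_natCast]
  rfl

theorem T_one_eq {r k : ℕ} (h0 : 0 < r) (hk : k ≤ 2 * r) :
    T r k 1 = pochNegX k (2 * r) * pochNegX (2 * r - k) (2 * r) * E (2 * r) := by
  rw [← triple_product (by lia) (by lia) (by lia)]
  rw [show (2 * r - k : ℤ) = ((2 * r - k : ℕ) : ℤ) by lia,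
    show (2 * r : ℤ) = ((2 * r : ℕ) : ℤ) by lia]
  simp only [mon_one_natCast]
  rfl

theorem E_two_eq : E 2 = pochX 2 10 * pochX 4 10 * pochX 6 10 * pochX 8 10 * E 10 := by
  simpa [E_eq_pochX, Finset.prod_range_succ] using pochX_split 2 (n := 2) (m := 5) (by norm_num) (by norm_num)

theorem E_five_eq : E 5 = pochX 5 10 * E 10 := by
  simpa [E_eq_pochX, Finset.prod_range_succ] using pochX_split 5 (n := 5) (m := 2) (by norm_num) (by norm_num)

theorem E_one_eq : E 1 = pochX 1 10 * pochX 3 10 * pochX 5 10 * pochX 7 10 * pochX 9 10 * E 2 := by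
  have h1 := pochX_split 1 (n := 1) (m := 2) (by norm_num) (by norm_num)
  have h2 := pochX_split 1 (n := 2) (m := 5) (by norm_num) (by norm_num)
  simp [Finset.prod_range_succ] at h1 h2
  rw [E_eq_pochX, h1, h2]
  rfl

theorem T_five_one_mul_T_five_three :
    T 5 1 (-1) * T 5 3 (-1) * E 2 * E 5 = E 1 * E 10 ^ 3 := by
  have h1 := T_neg_one_eq (r := 5) (k := 1) (by norm_num) (by norm_num)
  have h3 := T_neg_one_eq (r := 5) (k := 3) (by norm_num) (by norm_num)
  norm_num at h1 h3
  rw [h1, h3, E_one_eq, E_five_eq]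
  ring

theorem T_five_five_mul_E : T 5 5 (-1) * E 10 = E 5 ^ 2 := by
  have h := T_neg_one_eq (r := 5) (k := 5) (by norm_num) (by norm_num)
  norm_num at h
  rw [h, E_five_eq]
  ring

theorem T_five_two_mul_T_five_three : T 5 2 1 * T 5 3 1 * (T 5 2 (-1) * T 5 3 (-1)) =
    E 10 ^ 3 * T 5 4 (-1) := by
  have h2 := T_neg_one_eq (r := 5) (k := 2) (by norm_num) (by norm_num)
  have h3 := T_neg_one_eq (r := 5) (k := 3) (by norm_num) (by norm_num)
  have h4 := T_neg_one_eq (r := 5) (k := 4) (by norm_num) (by norm_num)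
  have b2 := T_one_eq (r := 5) (k := 2) (by norm_num) (by norm_num)
  have b3 := T_one_eq (r := 5) (k := 3) (by norm_num) (by norm_num)
  have p := fun i => pochNegX_mul_pochX i (n := 10) (by norm_num)
  have p2 := p 2
  have p3 := p 3
  have p7 := p 7
  have p8 := p 8
  have s4 := pochX_split 4 (n := 10) (m := 2) (by norm_num) (by norm_num)
  have s6 := pochX_split 6 (n := 10) (m := 2) (by norm_num) (by norm_num)
  norm_num [Finset.prod_range_succ] at h2 h3 h4 b2 b3 p2 p3 p7 p8 s4 s6
  rw [h2, h3, h4, b2, b3, s4, s6, ← p2, ← p3, ← p7, ← p8]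
  ring

theorem T_one_one_neg_mul_E : T 1 1 (-1) * E 2 = E 1 ^ 2 := by
  have h := T_neg_one_eq (r := 1) (k := 1) (by norm_num) (by norm_num)
  have s := pochX_split 1 (n := 1) (m := 2) (by norm_num) (by norm_num)
  norm_num [Finset.prod_range_succ] at h s
  rw [h, E_eq_pochX 1, s, E_eq_pochX 2]
  ring

theorem T_two_one_mul_E : T 2 1 1 * E 1 = E 2 ^ 2 := by
  have h := T_one_eq (r := 2) (k := 1) (by norm_num) (by norm_num)
  have s := pochX_split 1 (n := 1) (m := 2) (by norm_num) (by norm_num)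
  have t := pochNegX_split 1 (n := 2) (m := 2) (by norm_num) (by norm_num)
  have p := pochNegX_mul_pochX 1 (n := 2) (by norm_num)
  have e := pochX_split 2 (n := 2) (m := 2) (by norm_num) (by norm_num)
  norm_num [Finset.prod_range_succ] at h s t p e
  rw [h, ← t, E_eq_pochX 1, s, E_eq_pochX 2, E_eq_pochX 4, e, ← p]
  ring

theorem T_one_one_mul_E : T 1 1 1 * E 1 ^ 2 * E 4 ^ 2 = E 2 ^ 5 := by
  have h := T_one_eq (r := 1) (k := 1) (by norm_num) (by norm_num)
  have s := pochX_split 1 (n := 1) (m := 2) (by norm_num) (by norm_num)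
  have p := pochNegX_mul_pochX 1 (n := 2) (by norm_num)
  have e := pochX_split 2 (n := 2) (m := 2) (by norm_num) (by norm_num)
  norm_num [Finset.prod_range_succ] at h s p e
  rw [h, E_eq_pochX 1, s, E_eq_pochX 2, E_eq_pochX 4, e, ← p]
  ring

theorem T_five_two_mul_T_five_four_one : T 5 2 1 * T 5 4 1 * E 2 * E 20 = E 4 * E 10 ^ 3 := by
  have b2 := T_one_eq (r := 5) (k := 2) (by norm_num) (by norm_num)
  have b4 := T_one_eq (r := 5) (k := 4) (by norm_num) (by norm_num)
  have p := fun i => pochNegX_mul_pochX i (n := 10) (by norm_num)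
  have p2 := p 2
  have p4 := p 4
  have p6 := p 6
  have p8 := p 8
  have s := pochX_split 4 (n := 4) (m := 5) (by norm_num) (by norm_num)
  norm_num [Finset.prod_range_succ] at b2 b4 p2 p4 p6 p8 s
  rw [b2, b4, E_two_eq, E_eq_pochX 4, s, ← p2, ← p4, ← p6, ← p8, E_eq_pochX 20]
  ring

end AppellLerch

namespace AppellLerch

open PowerSeries Filter Topology
open scoped PowerSeries.WithPiTopology

/-! ### The dissection formula -/

theorem isUnit_E {j : ℕ} (hj : j ≠ 0) : IsUnit (E j) :=
  isUnit_qPochInf (by simp [hj]) (by simp [hj])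

theorem phi_X_pow (j : ℕ) : phi (X ^ j) = T j j 1 := by
  unfold phi theta T
  refine tsum_congr fun n => ?_
  have e1 := two_mul_tri n
  have e2 := two_mul_tri (n - 1)
  have h1 := mul_succ_nonneg n
  have h2 := mul_pred_nonneg n
  rw [sub_add_cancel, mul_comm (n - 1) n] at e2
  obtain ⟨s, hs⟩ := Int.eq_ofNat_of_zero_le (show 0 ≤ n * (n + 1) / 2 by lia)
  obtain ⟨t, ht⟩ := Int.eq_ofNat_of_zero_le (show 0 ≤ n * (n - 1) / 2 by lia)
  rw [hs] at e1
  rw [ht] at e2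
  rw [hs, ht, Int.toNat_natCast, Int.toNat_natCast, one_zpow,
    show (j : ℤ) * (n * (n - 1)) + j * n = ((j * s + j * t : ℕ) : ℤ) by
      have h3 : (s : ℤ) = t + n := by lia
      push_cast
      rw [h3, ← e2]
      ring]
  rw [mon_one_natCast]
  ring

theorem psi_X_pow (j : ℕ) : psi (X ^ j) = T (2 * j) j 1 := by
  unfold psi theta T
  refine tsum_congr fun n => ?_
  have e1 := two_mul_tri n
  have e2 := two_mul_tri (n - 1)
  have h1 := mul_succ_nonneg n
  have h2 := mul_pred_nonneg n
  rw [sub_add_cancel, mul_comm (n - 1) n] at e2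
  obtain ⟨s, hs⟩ := Int.eq_ofNat_of_zero_le (show 0 ≤ n * (n + 1) / 2 by lia)
  obtain ⟨t, ht⟩ := Int.eq_ofNat_of_zero_le (show 0 ≤ n * (n - 1) / 2 by lia)
  rw [hs] at e1
  rw [ht] at e2
  rw [hs, ht, Int.toNat_natCast, Int.toNat_natCast, one_zpow,
    show 2 * (j : ℤ) * (n * (n - 1)) + j * n = ((j * s + 3 * j * t : ℕ) : ℤ) by
      have h3 : (s : ℤ) = t + n := by lia
      push_cast
      rw [h3, ← e2]
      ring]
  rw [mon_one_natCast]
  ring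

/-- `φ(q²) φ(q¹⁰) - 4 q³ ψ(q⁴) ψ(q²⁰)` -/
noncomputable def phiPsi : ℤ⟦X⟧ := T 2 2 1 * T 10 10 1 - 4 * X ^ 3 * T 8 4 1 * T 40 20 1

theorem T_one_one_eq (ε : ℤˣ) : T 1 1 ε = T 4 4 1 + 2 * mon ε 1 * T 16 8 1 := by
  have h1 := T_even_add_odd (r := 1) (k := 1) (by norm_num) (by norm_num) (by norm_num) ε
  have h2 := T_reflect 4 0 1
  have h3 := T_zero_one (r := 4) (by norm_num)
  norm_num at h1 h2 h3
  rw [h1, h2, h3]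
  ring

theorem T_five_five_eq (ε : ℤˣ) : T 5 5 ε = T 20 20 1 + 2 * mon ε 5 * T 80 40 1 := by
  have h1 := T_even_add_odd (r := 5) (k := 5) (by norm_num) (by norm_num) (by norm_num) ε
  have h2 := T_reflect 20 0 1
  have h3 := T_zero_one (r := 20) (by norm_num)
  norm_num at h1 h2 h3
  rw [h1, h2, h3]
  ring

theorem T_one_mul_T_neg_one {r k : ℤ} (h0 : 0 < r) (hk : 0 ≤ k) (hkr : k ≤ r) :
    T r k 1 * T r k (-1) = T (2 * r) (2 * k) (-1) * T (2 * r) (2 * r) (-1) := by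
  have h := T_mul_T h0 hk le_rfl (by lia) 1 (-1)
  rw [sub_self, one_mul, T_zero_neg_one, mul_zero, add_zero, zero_add, ← two_mul] at h
  exact h

/-- Insert φ(±q) = φ(q⁴) ± 2q ψ(q⁸) and its analogue at q⁵. The mixed terms cancel. -/
theorem two_mul_expand_phiPsi : 2 * expand 2 two_ne_zero phiPsi =
    T 1 1 1 * T 5 5 (-1) + T 1 1 (-1) * T 5 5 1 := by
  unfold phiPsi
  rw [T_one_one_eq, T_one_one_eq, T_five_five_eq, T_five_five_eq]
  have m1 : mon 1 1 = X := by simp [mon]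
  have m5 : mon 1 5 = X ^ 5 := mon_one_natCast 5
  rw [mon_neg, mon_neg, m1, m5]
  simp only [map_sub, map_mul, map_pow, expand_X, map_ofNat]
  rw [expand_T _ (by norm_num) (by norm_num) (by norm_num),
    expand_T _ (by norm_num) (by norm_num) (by norm_num),
    expand_T _ (by norm_num) (by norm_num) (by norm_num),
    expand_T _ (by norm_num) (by norm_num) (by norm_num)]
  norm_num
  ring

theorem T_one_one_neg_sq :
    T 1 1 (-1) ^ 2 = T 5 5 (-1) ^ 2 - 4 * (X * T 5 1 (-1) * T 5 3 (-1)) := by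
  have h := T_one_one_sq (-1)
  rw [mon_neg, show mon 1 1 = X by simp [mon]] at h
  linear_combination h

theorem T_one_one_one_sq : T 1 1 1 ^ 2 = T 5 5 1 ^ 2 + 4 * (X * T 5 1 1 * T 5 3 1) := by
  have h := T_one_one_sq 1
  rwa [show mon 1 1 = X by simp [mon]] at h

/-- At q² this is the square of the preceding identity. The squares of φ(±q) are given by the
Gaussian dissection, and the products of thetas at ε = 1 and ε = -1 become thetas in q². -/
theorem phiPsi_sq :
    phiPsi ^ 2 = T 5 5 (-1) ^ 4 + 4 * (X * T 5 1 (-1) * T 5 3 (-1)) ^ 2 := by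
  refine expand_injective two_ne_zero ?_
  have hB := two_mul_expand_phiPsi
  have a1 := T_one_one_one_sq
  have a2 := T_one_one_neg_sq
  have a3 := congrArg (expand 2 two_ne_zero) a2
  have m1 := T_one_mul_T_neg_one (r := 1) (k := 1) (by norm_num) (by norm_num) (by norm_num)
  have m5 := T_one_mul_T_neg_one (r := 5) (k := 5) (by norm_num) (by norm_num) (by norm_num)
  have m51 := T_one_mul_T_neg_one (r := 5) (k := 1) (by norm_num) (by norm_num) (by norm_num)
  have m53 := T_one_mul_T_neg_one (r := 5) (k := 3) (by norm_num) (by norm_num) (by norm_num)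
  simp only [map_sub, map_add, map_mul, map_pow, expand_X, map_ofNat] at a3 ⊢
  rw [expand_T _ (by norm_num) (by norm_num) (by norm_num),
    expand_T _ (by norm_num) (by norm_num) (by norm_num),
    expand_T _ (by norm_num) (by norm_num) (by norm_num)] at a3 ⊢
  rw [expand_T _ (by norm_num) (by norm_num) (by norm_num)] at a3
  norm_num at a3 m1 m5 m51 m53 ⊢
  refine mul_left_cancel₀ (pow_ne_zero 2 two_ne_zero_series) ?_
  rw [← mul_pow, hB]
  linear_combination (T 5 5 (-1) ^ 2 - T 1 1 (-1) ^ 2) * a1 +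
    (T 5 5 1 ^ 2 - (T 5 5 1 ^ 2 + 4 * (X * T 5 1 1 * T 5 3 1))) * a2 +
    (2 * T 5 5 1 * T 5 5 (-1) + T 1 1 1 * T 1 1 (-1) + T 2 2 (-1) ^ 2) * m1 +
    (2 * T 2 2 (-1) ^ 2 + T 5 5 1 * T 5 5 (-1) + T 10 10 (-1) ^ 2) * m5 +
    (3 * T 10 10 (-1) ^ 2 + T 2 2 (-1) ^ 2 - 4 * (X ^ 2 * T 10 2 (-1) * T 10 6 (-1))) * a3 +
    16 * X ^ 2 * (T 5 3 1 * T 5 3 (-1) * m51 + T 10 2 (-1) * T 10 10 (-1) * m53)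

theorem phiPsi_formula : 2 * X * T 5 5 (-1) * T 5 4 (-1) * T 5 1 (-1) ^ 2 =
    T 5 2 (-1) * T 5 3 (-1) *
      (T 5 5 (-1) ^ 2 + 2 * (X * T 5 1 (-1) * T 5 3 (-1)) - phiPsi) := by
  have c : ∀ k : ℤ, 0 < k → k < 10 → constantCoeff (T 5 k (-1)) = 1 := fun k h1 h2 =>
    constantCoeff_T h1 (by lia) _
  have n : ∀ k : ℤ, 0 < k → k < 10 → T 5 k (-1) ≠ 0 := fun k h1 h2 =>
    T_ne_zero h1 (by lia) _
  have n1 := n 1 (by norm_num) (by norm_num)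
  have n4 := n 4 (by norm_num) (by norm_num)
  have c1 := c 1 (by norm_num) (by norm_num)
  have c2 := c 2 (by norm_num) (by norm_num)
  have c3 := c 3 (by norm_num) (by norm_num)
  have c4 := c 4 (by norm_num) (by norm_num)
  have c5 := c 5 (by norm_num) (by norm_num)
  have hc : constantCoeff phiPsi = 1 := by
    unfold phiPsi
    simp [constantCoeff_T]
  have hβ := T_five_sextic n4
  have hγ := phiPsi_sq
  set J1 := T 5 1 (-1)
  set J2 := T 5 2 (-1)
  set J3 := T 5 3 (-1)
  set J4 := T 5 4 (-1)
  set J5 := T 5 5 (-1)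
  -- The difference of squares (P - Q)² - D² Φ², in the notation of the introductory comment.
  have h : (J5 * (J2 ^ 2 * J3 ^ 3 - X * J4 ^ 2 * J1 ^ 3) - J1 * J2 * J3 * J4 * phiPsi) *
      (J5 * (J2 ^ 2 * J3 ^ 3 - X * J4 ^ 2 * J1 ^ 3) + J1 * J2 * J3 * J4 * phiPsi) = 0 := by
    linear_combination (J5 * (X * J4 ^ 2 * J1 ^ 3 + J2 ^ 2 * J3 ^ 3) + J1 * J2 * J3 * J4 *
      (J5 ^ 2 + 2 * (X * J1 * J3))) * hβ - (J1 * J2 * J3 * J4) ^ 2 * hγ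
  rcases mul_eq_zero.mp h with h | h
  · refine mul_left_cancel₀ (mul_ne_zero n1 n4) ?_
    linear_combination hβ - h
  -- The other factor has constant term 2, so it cannot vanish.
  · have := congrArg constantCoeff h
    simp [c1, c2, c3, c4, c5, hc] at this

theorem odd_part_formula :
    2 * PowerSeries.mk (fun n : ℕ => a 3 10 (2 * n + 1)) * (E 1 ^ 2 * E 5) =
      E 2 ^ 2 * (T 5 5 (-1) ^ 2 + 2 * (X * T 5 1 (-1) * T 5 3 (-1)) - phiPsi) := by
  have h1 := odd_part_appellSeries
  have h2 := phiPsi_formula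
  have e1 := T_five_one_mul_T_five_three
  have e2 := T_five_five_mul_E
  have e3 := T_five_two_mul_T_five_three
  have n2 : T 5 2 (-1) ≠ 0 := T_ne_zero (by norm_num) (by norm_num) _
  have n3 : T 5 3 (-1) ≠ 0 := T_ne_zero (by norm_num) (by norm_num) _
  have n5 := (isUnit_E (show 5 ≠ 0 by norm_num)).ne_zero
  have n10 := (isUnit_E (show 10 ≠ 0 by norm_num)).ne_zero
  set O := PowerSeries.mk (fun n : ℕ => a 3 10 (2 * n + 1))
  set J1 := T 5 1 (-1)
  set J2 := T 5 2 (-1)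
  set J3 := T 5 3 (-1)
  set J4 := T 5 4 (-1)
  set J5 := T 5 5 (-1)
  set S := J5 ^ 2 + 2 * (X * J1 * J3) - phiPsi
  have h3 : 2 * O * (J1 * J3) ^ 2 * J5 ^ 3 = E 5 ^ 3 * E 10 ^ 3 * S := by
    refine mul_left_cancel₀ (mul_ne_zero n2 n3) ?_
    linear_combination 2 * J2 * J3 * J5 * J1 ^ 2 * h1 + 2 * X * E 5 ^ 3 * J5 * J1 ^ 2 * e3 +
      E 5 ^ 3 * E 10 ^ 3 * h2
  refine mul_left_cancel₀ (mul_ne_zero (pow_ne_zero 5 n5) (pow_ne_zero 6 n10)) ?_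
  linear_combination E 2 ^ 2 * E 5 ^ 2 * E 10 ^ 3 * h3 -
    2 * O * J5 ^ 3 * E 10 ^ 3 * (J1 * J3 * E 2 * E 5 + E 1 * E 10 ^ 3) * e1 -
    2 * O * (E 1 * E 10 ^ 3) ^ 2 * ((J5 * E 10) ^ 2 + J5 * E 10 * E 5 ^ 2 + E 5 ^ 4) * e2

/-- Write J_5² + 2q J_1 J_3 = φ(-q)² + 6q J_1 J_3, with φ(-q) = E_1²/E_2 and J_1 J_3 = E_1
E_10³/(E_2 E_5); the constant 6 is 2 + 4. -/
theorem odd_part_dissection :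
    2 * PowerSeries.mk (fun n : ℕ => a 3 10 (2 * n + 1)) =
      E 1 ^ 2 * Ring.inverse (E 5)
        + 6 * X * (E 2 * E 10 ^ 3) * Ring.inverse (E 1 * E 5 ^ 2)
        - E 2 ^ 2 * Ring.inverse (E 1 ^ 2 * E 5)
            * (phi (X ^ 2) * phi (X ^ 10) - 4 * X ^ 3 * psi (X ^ 4) * psi (X ^ 20)) := by
  have hB : phi (X ^ 2) * phi (X ^ 10) - 4 * X ^ 3 * psi (X ^ 4) * psi (X ^ 20) = phiPsi := by
    rw [phi_X_pow, phi_X_pow, psi_X_pow, psi_X_pow, phiPsi]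
    norm_num
  rw [hB]
  have u1 := isUnit_E (show 1 ≠ 0 by norm_num)
  have u5 := isUnit_E (show 5 ≠ 0 by norm_num)
  have h := odd_part_formula
  have h1 := T_one_one_neg_sq
  have h2 := T_one_one_neg_mul_E
  have h3 := T_five_one_mul_T_five_three
  have i1 := Ring.mul_inverse_cancel _ u5
  have i2 := Ring.mul_inverse_cancel _ (u1.mul (u5.pow 2))
  have i3 := Ring.mul_inverse_cancel _ ((u1.pow 2).mul u5)
  refine mul_left_cancel₀ ((u1.pow 2).mul (u5.pow 2)).ne_zero ?_
  linear_combination E 5 * h - E 5 * E 2 ^ 2 * h1 + E 5 * (T 1 1 (-1) * E 2 + E 1 ^ 2) * h2 +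
    6 * X * E 2 * h3 - E 1 ^ 4 * E 5 * i1 - 6 * X * E 2 * E 10 ^ 3 * E 1 * i2 +
    E 2 ^ 2 * E 5 * phiPsi * i3

end AppellLerch

namespace AppellLerch

open PowerSeries Filter Topology
open scoped PowerSeries.WithPiTopology

/-! ### The congruence -/

/-- Splitting the integers into residue classes modulo `5`, with representatives `-2, …, 2`. -/
def modFiveEquiv : Fin 5 × ℤ ≃ ℤ where
  toFun x := 5 * x.2 + (x.1.val - 2)
  invFun n := (⟨((n + 2) % 5).toNat, by lia⟩, (n + 2) / 5)
  left_inv := by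
    rintro ⟨⟨b, hb⟩, m⟩
    simp only [Prod.mk.injEq, Fin.mk.injEq]
    lia
  right_inv n := by
    dsimp only
    lia

/-- The 5-dissection of ψ(q²). Four of the residue classes of n pair off as the even and odd halves
of `T 5 4 1` and `T 5 2 1` at q⁵, and the remaining one is `T 20 10 1` at q⁵. -/
theorem T_four_two_eq : T 4 2 1 = expand 5 (by norm_num) (T 5 4 1) +
    X ^ 2 * expand 5 (by norm_num) (T 5 2 1) + X ^ 6 * expand 5 (by norm_num) (T 20 10 1) := by
  have h4 := T_even_add_odd (r := 5) (k := 4) (by norm_num) (by norm_num) (by norm_num) 1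
  have h2 := T_even_add_odd (r := 5) (k := 2) (by norm_num) (by norm_num) (by norm_num) 1
  have m4 : mon 1 4 = X ^ 4 := mon_one_natCast 4
  have m2 : mon 1 2 = X ^ 2 := mon_one_natCast 2
  norm_num at h4 h2
  have r1 := T_reflect 100 190 1
  have r2 := T_reflect 100 130 1
  have h : T 4 2 1 = X ^ 20 * T 100 10 1 + X ^ 6 * T 100 50 1 + T 100 90 1 + X ^ 2 * T 100 130 1 +
      X ^ 12 * T 100 170 1 := by
    have hT : ∀ k : ℤ, 0 ≤ k → k ≤ 200 → Small fun n : ℤ =>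
        mon (1 ^ n) (100 * (n * (n - 1)) + k * n) := fun k h1 h2 =>
      small_mon (by norm_num) h1 (by lia) (1 ^ ·)
    have hX : ∀ d : ℕ, X ^ d = mon 1 d := fun d => (mon_one_natCast d).symm
    unfold T
    rw [(small_mon (by norm_num) (by norm_num) (by norm_num) (1 ^ ·)).sum_equiv modFiveEquiv,
      Fin.sum_univ_five, (hT _ (by norm_num) (by norm_num)).const_mul_tsum,
      (hT _ (by norm_num) (by norm_num)).const_mul_tsum,
      (hT _ (by norm_num) (by norm_num)).const_mul_tsum,
      (hT _ (by norm_num) (by norm_num)).const_mul_tsum]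
    simp only [hX]
    congr 1
    · congr 1
      · congr 1
        · congr 1
          · refine tsum_congr fun n => ?_
            rw [mon_mul_mon _ _ (by norm_num) (exponent_nonneg (by norm_num) (by norm_num) n)]
            simp only [modFiveEquiv, Equiv.coe_fn_mk, one_zpow, mul_one]
            congr 1
            norm_num
            ring
          · refine tsum_congr fun n => ?_
            rw [mon_mul_mon _ _ (by norm_num) (exponent_nonneg (by norm_num) (by norm_num) n)]
            simp only [modFiveEquiv, Equiv.coe_fn_mk, one_zpow, mul_one]
            congr 1
            norm_num
            ring
        · refine tsum_congr fun n => ?_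
          simp only [modFiveEquiv, Equiv.coe_fn_mk, one_zpow]
          congr 1
          norm_num
          ring
      · refine tsum_congr fun n => ?_
        rw [mon_mul_mon _ _ (by norm_num) (exponent_nonneg (by norm_num) (by norm_num) n)]
        simp only [modFiveEquiv, Equiv.coe_fn_mk, one_zpow, mul_one]
        congr 1
        norm_num
        ring
    · refine tsum_congr fun n => ?_
      rw [mon_mul_mon _ _ (by norm_num) (exponent_nonneg (by norm_num) (by norm_num) n)]
      simp only [modFiveEquiv, Equiv.coe_fn_mk, one_zpow, mul_one]
      congr 1
      norm_num
      ring
  rw [h, h4, h2, m2, m4, map_add, map_add, map_mul, map_mul, map_pow, map_pow, expand_X]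
  rw [expand_T _ (by norm_num) (by norm_num) (by norm_num),
    expand_T _ (by norm_num) (by norm_num) (by norm_num),
    expand_T _ (by norm_num) (by norm_num) (by norm_num),
    expand_T _ (by norm_num) (by norm_num) (by norm_num),
    expand_T _ (by norm_num) (by norm_num) (by norm_num)]
  norm_num at r1 r2 ⊢
  rw [r1, r2]
  ring

/-! ### Residue classes of exponents and divisibility by 5 -/

/-- The exponents of `f` lie in the residue class `c` modulo `5`. -/
def ResidueClass (c : ZMod 5) (f : ℤ⟦X⟧) : Prop := ∀ n : ℕ, (n : ZMod 5) ≠ c → coeff n f = 0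

theorem ResidueClass.mul {c d : ZMod 5} {f g : ℤ⟦X⟧} (hf : ResidueClass c f)
    (hg : ResidueClass d g) : ResidueClass (c + d) (f * g) := by
  intro n hn
  rw [coeff_mul]
  refine Finset.sum_eq_zero fun x hx => ?_
  rw [Finset.HasAntidiagonal.mem_antidiagonal] at hx
  by_cases h : (x.1 : ZMod 5) = c
  · rw [hg, mul_zero]
    rintro rfl
    apply hn
    rw [← hx, ← h, Nat.cast_add]
  · rw [hf _ h, zero_mul]

theorem residueClass_natCast (m : ℕ) : ResidueClass 0 (m : ℤ⟦X⟧) := by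
  intro n hn
  rw [← map_natCast (C (R := ℤ)), coeff_C, if_neg]
  rintro rfl
  simp at hn

theorem residueClass_X_pow (m : ℕ) : ResidueClass m (X ^ m) := by
  intro n hn
  rw [coeff_X_pow, if_neg]
  rintro rfl
  exact hn rfl

theorem ResidueClass.pow {c : ZMod 5} {f : ℤ⟦X⟧} (hf : ResidueClass c f) (m : ℕ) :
    ResidueClass (m * c) (f ^ m) := by
  induction m with
  | zero => simpa using residueClass_natCast 1
  | succ m ih =>
    rw [pow_succ, Nat.cast_succ, add_one_mul]
    exact ih.mul hf

theorem residueClass_expand (f : ℤ⟦X⟧) : ResidueClass 0 (expand 5 (by norm_num) f) := by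
  intro n hn
  refine coeff_expand_of_not_dvd _ _ _ fun h => hn ?_
  rwa [ZMod.natCast_eq_zero_iff]

/-- The coefficients of `f` with index in the residue class `c` modulo `5` are divisible by `5`. -/
def FiveDvd (c : ZMod 5) (f : ℤ⟦X⟧) : Prop := ∀ n : ℕ, (n : ZMod 5) = c → (5 : ℤ) ∣ coeff n f

theorem FiveDvd.add {c : ZMod 5} {f g : ℤ⟦X⟧} (hf : FiveDvd c f) (hg : FiveDvd c g) :
    FiveDvd c (f + g) := fun n hn => by
  rw [map_add]
  exact dvd_add (hf n hn) (hg n hn)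

theorem FiveDvd.sub {c : ZMod 5} {f g : ℤ⟦X⟧} (hf : FiveDvd c f) (hg : FiveDvd c g) :
    FiveDvd c (f - g) := fun n hn => by
  rw [map_sub]
  exact dvd_sub (hf n hn) (hg n hn)

theorem fiveDvd_five_mul (c : ZMod 5) (f : ℤ⟦X⟧) : FiveDvd c (5 * f) := fun n _ => by
  rw [show (5 : ℤ⟦X⟧) = C 5 from rfl, coeff_C_mul]
  exact dvd_mul_right _ _

theorem ResidueClass.fiveDvd {c d : ZMod 5} {f : ℤ⟦X⟧} (hf : ResidueClass d f) (h : c ≠ d) :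
    FiveDvd c f := by
  rintro n rfl
  rw [hf n h]
  exact dvd_zero _

theorem FiveDvd.expand_mul {c : ZMod 5} {f : ℤ⟦X⟧} (hf : FiveDvd c f) (g : ℤ⟦X⟧) :
    FiveDvd c (expand 5 (by norm_num) g * f) := by
  rintro n rfl
  rw [coeff_mul]
  refine Finset.dvd_sum fun x hx => ?_
  rw [Finset.HasAntidiagonal.mem_antidiagonal] at hx
  by_cases h : (x.1 : ZMod 5) = 0
  · refine (hf _ ?_).mul_left _
    rw [← hx, Nat.cast_add, h, zero_add]
  · rw [residueClass_expand g _ h, zero_mul]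
    exact dvd_zero _

theorem FiveDvd.of_expand_mul {c : ZMod 5} {f g : ℤ⟦X⟧} (hg : IsUnit g)
    (h : FiveDvd c (expand 5 (by norm_num) g * f)) : FiveDvd c f := by
  have h1 := h.expand_mul (Ring.inverse g)
  rwa [← mul_assoc, ← map_mul, Ring.inverse_mul_cancel _ hg, map_one, one_mul] at h1

theorem FiveDvd.of_expand_two {c : ZMod 5} {f : ℤ⟦X⟧}
    (h : FiveDvd (2 * c) (expand 2 two_ne_zero f)) : FiveDvd c f := by
  rintro n rfl
  have := h (2 * n) (by push_cast; rfl)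
  rwa [coeff_expand_mul] at this

theorem fiveDvd_monomial {A B C : ℤ⟦X⟧} (hA : ResidueClass 0 A) (hB : ResidueClass 2 B)
    (hC : ResidueClass 1 C) {c : ZMod 5} (m i j k : ℕ) (h : c ≠ j * 2 + k) :
    FiveDvd c (m * (A ^ i * B ^ j * C ^ k)) := by
  have h1 := (residueClass_natCast m).mul (((hA.pow i).mul (hB.pow j)).mul (hC.pow k))
  refine h1.fiveDvd ?_
  simpa using h

/-- The monomials of exponent class 4 are A²B², ABC² and C⁴, with coefficients 6 - 1, 12 - 2 and 1 -
1. -/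
theorem fiveDvd_quartic {A B C : ℤ⟦X⟧} (hA : ResidueClass 0 A) (hB : ResidueClass 2 B)
    (hC : ResidueClass 1 C) : FiveDvd 4 ((A + B + C) ^ 4 - (A * B + C ^ 2) ^ 2) := by
  have m := fun m i j k h => fiveDvd_monomial hA hB hC (c := 4) m i j k h
  have h := ((((((((((((m 1 4 0 0 (by decide)).add (m 4 3 1 0 (by decide))).add
    (m 4 1 3 0 (by decide))).add (m 1 0 4 0 (by decide))).add (m 4 3 0 1 (by decide))).add
    (m 12 2 1 1 (by decide))).add (m 12 1 2 1 (by decide))).add (m 4 0 3 1 (by decide))).add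
    (m 6 2 0 2 (by decide))).add (m 6 0 2 2 (by decide))).add (m 4 1 0 3 (by decide))).add
    (m 4 0 1 3 (by decide))).add (fiveDvd_five_mul 4 (A ^ 2 * B ^ 2 + 2 * (A * B * C ^ 2)))
  convert h using 1
  push_cast
  ring

/-- The monomials of exponent class 3 are ABC and C³, with coefficients 6 - 1 and 1 - 1. -/
theorem fiveDvd_cubic {A B C : ℤ⟦X⟧} (hA : ResidueClass 0 A) (hB : ResidueClass 2 B)
    (hC : ResidueClass 1 C) :
    FiveDvd 3 ((A + B + C) ^ 3 - (A * B + C ^ 2) * (A + B + C)) := by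
  have m := fun m i j k h => fiveDvd_monomial hA hB hC (c := 3) m i j k h
  have h := ((((((((m 1 3 0 0 (by decide)).add (m 2 2 1 0 (by decide))).add
    (m 2 1 2 0 (by decide))).add (m 1 0 3 0 (by decide))).add (m 3 2 0 1 (by decide))).add
    (m 3 0 2 1 (by decide))).add (m 2 1 0 2 (by decide))).add (m 2 0 1 2 (by decide))).add
    (fiveDvd_five_mul 3 (A * B * C))
  convert h using 1
  push_cast
  ring

/-- Applying q ↦ q⁵ to `T_four_two_sq` shows that AB + C² = q² ψ(q¹⁰)² for the components A, B, C of
ψ(q²). -/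
theorem fiveDvd_psi : FiveDvd 4 (T 4 2 1 ^ 4 - (X ^ 2 * T 20 10 1 ^ 2) ^ 2) ∧
    FiveDvd 3 (T 4 2 1 ^ 3 - X ^ 2 * T 20 10 1 ^ 2 * T 4 2 1) := by
  have hA := residueClass_expand (T 5 4 1)
  have hB := (residueClass_X_pow 2).mul (residueClass_expand (T 5 2 1))
  have hC := (residueClass_X_pow 6).mul (residueClass_expand (T 20 10 1))
  have h2 : ((2 : ℕ) : ZMod 5) + 0 = 2 := rfl
  have h6 : ((6 : ℕ) : ZMod 5) + 0 = 1 := rfl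
  rw [h2] at hB
  rw [h6] at hC
  have hs := congrArg (expand 5 (by norm_num)) T_four_two_sq
  rw [map_pow, map_add, map_mul, map_mul, map_pow, map_pow, expand_X,
    expand_T _ (show (0 : ℤ) < 4 by norm_num) (by norm_num) (by norm_num)] at hs
  norm_num at hs
  have h4 := fiveDvd_quartic hA hB hC
  have h3 := fiveDvd_cubic hA hB hC
  have e : X ^ 2 * T 20 10 1 ^ 2 = expand 5 (by norm_num) (T 5 4 1) *
      (X ^ 2 * expand 5 (by norm_num) (T 5 2 1)) +
      (X ^ 6 * expand 5 (by norm_num) (T 20 10 1)) ^ 2 := by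
    linear_combination X ^ 2 * hs
  rw [← T_four_two_eq, ← e] at h3 h4
  exact ⟨h4, h3⟩

/-! ### Reduction of the odd part to ψ(q) and ψ(q⁵) -/

/-- `E₂ / E₁` -/
noncomputable def eulerQuot : ℤ⟦X⟧ := E 2 * Ring.inverse (E 1)

theorem eulerQuot_mul_E : eulerQuot * E 1 = E 2 := by
  rw [eulerQuot, mul_assoc, Ring.inverse_mul_cancel _ (isUnit_E one_ne_zero), mul_one]

/-- At q² the right-hand factor is f(q²,q⁸) f(q⁴,q⁶) by `T_four_two_sq`, an eta quotient. -/
theorem eulerQuot_mul : eulerQuot * E 5 ^ 3 = E 10 * (T 2 1 1 ^ 2 - X * T 10 5 1 ^ 2) := by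
  refine expand_injective two_ne_zero ?_
  have h := congrArg (expand 2 two_ne_zero) eulerQuot_mul_E
  have h1 := T_four_two_sq
  have h2 := T_five_two_mul_T_five_four_one
  have h3 := T_five_five_mul_E
  simp only [map_mul, map_pow, map_sub, expand_X] at h ⊢
  rw [expand_E _ (by norm_num), expand_E _ (by norm_num)] at h
  rw [expand_E _ (by norm_num), expand_E _ (by norm_num),
    expand_T _ (by norm_num) (by norm_num) (by norm_num),
    expand_T _ (by norm_num) (by norm_num) (by norm_num)]
  norm_num at h ⊢
  refine mul_left_cancel₀ (isUnit_E (show 2 ≠ 0 by norm_num)).ne_zero ?_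
  linear_combination E 10 ^ 3 * h - h2 - E 20 * E 2 * h1

theorem psi_five_mul : T 10 5 1 * E 5 = E 10 ^ 2 := by
  have h := congrArg (expand 5 (by norm_num)) T_two_one_mul_E
  rw [map_mul, map_pow, expand_E _ (by norm_num), expand_E _ (by norm_num),
    expand_T _ (by norm_num) (by norm_num) (by norm_num)] at h
  norm_num at h
  exact h

theorem expand_five_E_one : expand 5 (by norm_num) (E 1) = E 5 := expand_E _ (by norm_num)

theorem fiveDvd_main :
    FiveDvd 2 (eulerQuot ^ 2 * (T 5 5 (-1) ^ 2 + 2 * (X * T 5 1 (-1) * T 5 3 (-1)))) := by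
  refine FiveDvd.of_expand_mul ((isUnit_E one_ne_zero).pow 2) ?_
  rw [map_pow, expand_five_E_one]
  -- With G = ψ(q)² - q ψ(q⁵)² the left side is G (G + 2q ψ(q⁵)²), a difference of squares.
  have h : E 5 ^ 2 * (eulerQuot ^ 2 * (T 5 5 (-1) ^ 2 + 2 * (X * T 5 1 (-1) * T 5 3 (-1)))) =
      T 2 1 1 ^ 4 - (X * T 10 5 1 ^ 2) ^ 2 := by
    have u1 := (isUnit_E (show 1 ≠ 0 by norm_num)).ne_zero
    have u2 := (isUnit_E (show 2 ≠ 0 by norm_num)).ne_zero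
    have u5 := (isUnit_E (show 5 ≠ 0 by norm_num)).ne_zero
    have u10 := (isUnit_E (show 10 ≠ 0 by norm_num)).ne_zero
    have h1 := eulerQuot_mul_E
    have h2 := eulerQuot_mul
    have h3 := psi_five_mul
    have h4 := T_five_five_mul_E
    have h5 := T_five_one_mul_T_five_three
    set G := T 2 1 1 ^ 2 - X * T 10 5 1 ^ 2 with hG
    have h6 : T 5 1 (-1) * T 5 3 (-1) * eulerQuot * E 5 = E 10 ^ 3 := by
      refine mul_left_cancel₀ u1 ?_
      linear_combination h5 + T 5 1 (-1) * T 5 3 (-1) * E 5 * h1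
    have h7 : E 5 ^ 2 * (T 5 5 (-1) * eulerQuot) ^ 2 = G ^ 2 := by
      refine mul_left_cancel₀ (pow_ne_zero 4 u5) ?_
      linear_combination T 5 5 (-1) ^ 2 * (eulerQuot * E 5 ^ 3 + E 10 * G) * h2 +
        G ^ 2 * (T 5 5 (-1) * E 10 + E 5 ^ 2) * h4
    have h8 : E 5 ^ 2 * (eulerQuot ^ 2 * (X * T 5 1 (-1) * T 5 3 (-1))) =
        X * T 10 5 1 ^ 2 * G := by
      refine mul_left_cancel₀ (pow_ne_zero 2 u5) ?_
      linear_combination X * eulerQuot * E 5 ^ 3 * h6 + X * E 10 ^ 3 * h2 -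
        X * G * (T 10 5 1 * E 5 + E 10 ^ 2) * h3
    linear_combination h7 + 2 * h8
  rw [h]
  refine FiveDvd.of_expand_two ?_
  simp only [map_sub, map_mul, map_pow, expand_X]
  rw [expand_T _ (by norm_num) (by norm_num) (by norm_num),
    expand_T _ (by norm_num) (by norm_num) (by norm_num)]
  norm_num
  exact fiveDvd_psi.1

theorem fiveDvd_phi :
    FiveDvd 4 (expand 2 two_ne_zero eulerQuot ^ 2 * T 1 1 1 * T 5 5 (-1)) := by
  refine FiveDvd.of_expand_mul (isUnit_E one_ne_zero) ?_
  rw [expand_five_E_one]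
  -- Here U(q²)² φ(q) = U ψ(q), while E_5 U φ(-q⁵) = ψ(q)² - q ψ(q⁵)².
  have h : E 5 * (expand 2 two_ne_zero eulerQuot ^ 2 * T 1 1 1 * T 5 5 (-1)) =
      T 2 1 1 ^ 3 - X * T 10 5 1 ^ 2 * T 2 1 1 := by
    have u1 := (isUnit_E (show 1 ≠ 0 by norm_num)).ne_zero
    have u2 := (isUnit_E (show 2 ≠ 0 by norm_num)).ne_zero
    have u5 := (isUnit_E (show 5 ≠ 0 by norm_num)).ne_zero
    have h1 := eulerQuot_mul_E
    have h2 := eulerQuot_mul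
    have h4 := T_five_five_mul_E
    have h5 := T_one_one_mul_E
    have h6 := T_two_one_mul_E
    have h7 := congrArg (expand 2 two_ne_zero) eulerQuot_mul_E
    rw [map_mul, expand_E _ (by norm_num), expand_E _ (by norm_num)] at h7
    norm_num at h7
    set V := expand 2 two_ne_zero eulerQuot
    have h8 : V ^ 2 * T 1 1 1 = eulerQuot * T 2 1 1 := by
      refine mul_left_cancel₀ (mul_ne_zero (pow_ne_zero 2 u1) (pow_ne_zero 2 u2)) ?_
      linear_combination E 1 ^ 2 * T 1 1 1 * (V * E 2 + E 4) * h7 + h5 -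
        E 2 ^ 2 * E 1 * T 2 1 1 * h1 - E 2 ^ 3 * h6
    refine mul_left_cancel₀ (pow_ne_zero 2 u5) ?_
    linear_combination E 5 ^ 3 * T 5 5 (-1) * h8 + T 2 1 1 * T 5 5 (-1) * h2 +
      T 2 1 1 * (T 2 1 1 ^ 2 - X * T 10 5 1 ^ 2) * h4
  rw [h]
  refine FiveDvd.of_expand_two ?_
  simp only [map_sub, map_mul, map_pow, expand_X]
  rw [expand_T _ (by norm_num) (by norm_num) (by norm_num),
    expand_T _ (by norm_num) (by norm_num) (by norm_num)]
  norm_num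
  exact fiveDvd_psi.2

theorem evalNegHom_expand_two (f : ℤ⟦X⟧) :
    evalNegHom (expand 2 two_ne_zero f) = expand 2 two_ne_zero f := by
  ext n
  rw [evalNegHom, coeff_rescale]
  rcases Nat.even_or_odd n with h | h
  · rw [h.neg_one_pow, one_mul]
  · rw [coeff_expand_of_not_dvd _ _ _ (by
      rintro ⟨c, rfl⟩
      exact (Nat.not_odd_iff_even.mpr (even_two_mul c)) h), mul_zero]

theorem fiveDvd_two_mul {c : ZMod 5} {f : ℤ⟦X⟧} (h : FiveDvd c (2 * f)) : FiveDvd c f := by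
  intro n hn
  have := h n hn
  rw [show (2 : ℤ⟦X⟧) = C 2 from rfl, coeff_C_mul] at this
  lia

theorem FiveDvd.evalNegHom {c : ZMod 5} {f : ℤ⟦X⟧} (h : FiveDvd c f) :
    FiveDvd c (evalNegHom f) := by
  intro n hn
  rw [PowerSeries.evalNegHom, coeff_rescale]
  exact (h n hn).mul_left _

/-- After q ↦ q², twice the series is the one in `fiveDvd_phi` plus its image under q ↦ -q, and the
class 2 becomes 4. -/
theorem fiveDvd_phiPsi : FiveDvd 2 (eulerQuot ^ 2 * phiPsi) := by
  refine FiveDvd.of_expand_two (fiveDvd_two_mul ?_)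
  have h := fiveDvd_phi.add fiveDvd_phi.evalNegHom
  have h1 := two_mul_expand_phiPsi
  rw [map_mul, map_mul, map_pow, evalNegHom_expand_two,
    map_T_of_neg evalNegHom_X (by decide) (by norm_num) (by norm_num) (by norm_num),
    map_T_of_neg evalNegHom_X (by decide) (by norm_num) (by norm_num) (by norm_num), neg_neg] at h
  rw [show (2 * 2 : ZMod 5) = 4 from rfl]
  convert h using 1
  rw [map_mul, map_pow]
  linear_combination expand 2 two_ne_zero eulerQuot ^ 2 * h1

theorem fiveDvd_odd_part : FiveDvd 2 (PowerSeries.mk fun n : ℕ => a 3 10 (2 * n + 1)) := by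
  refine fiveDvd_two_mul (FiveDvd.of_expand_mul (isUnit_E one_ne_zero) ?_)
  rw [expand_five_E_one]
  convert fiveDvd_main.sub fiveDvd_phiPsi using 1
  have h1 := odd_part_formula
  have h2 := eulerQuot_mul_E
  refine mul_left_cancel₀ (pow_ne_zero 2 (isUnit_E one_ne_zero).ne_zero) ?_
  linear_combination h1 - (eulerQuot * E 1 + E 2) *
    (T 5 5 (-1) ^ 2 + 2 * (X * T 5 1 (-1) * T 5 3 (-1)) - phiPsi) * h2

theorem five_dvd_appell (n : ℕ) : a 3 10 (10 * n + 5) ≡ 0 [ZMOD 5] := by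
  -- The index 10n + 5 is 2(5n + 2) + 1, hence class 2 modulo 5 in the odd part.
  have h := fiveDvd_odd_part (5 * n + 2) (by
    push_cast
    rw [show (5 : ZMod 5) = 0 from rfl, zero_mul, zero_add])
  rw [coeff_mk, show 2 * (5 * n + 2) + 1 = 10 * n + 5 by ring] at h
  exact Int.modEq_zero_iff_dvd.mpr h

end AppellLerch

theorem mainTheorem5 :
    (2 * PowerSeries.mk (fun n : ℕ => AppellLerch.a 3 10 (2 * n + 1)) =
      AppellLerch.E 1 ^ 2 * Ring.inverse (AppellLerch.E 5)
        + 6 * PowerSeries.X * (AppellLerch.E 2 * AppellLerch.E 10 ^ 3)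
            * Ring.inverse (AppellLerch.E 1 * AppellLerch.E 5 ^ 2)
        - AppellLerch.E 2 ^ 2 * Ring.inverse (AppellLerch.E 1 ^ 2 * AppellLerch.E 5)
            * (AppellLerch.phi (PowerSeries.X ^ 2) * AppellLerch.phi (PowerSeries.X ^ 10)
                - 4 * PowerSeries.X ^ 3 * AppellLerch.psi (PowerSeries.X ^ 4)
                    * AppellLerch.psi (PowerSeries.X ^ 20))) ∧
    ∀ n : ℕ, AppellLerch.a 3 10 (10 * n + 5) ≡ 0 [ZMOD 5] :=
  ⟨AppellLerch.odd_part_dissection, AppellLerch.five_dvd_appell⟩
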